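/- \textbf{Setting.} Let $A_1,A_2,B$ be unital C*-algebras, let $\iota_k:B\to A_k$ be unital $*$-homomorphisms with conditional expectations $E_k:A_k\to B$ (completely positive maps with $E_k(\iota_k(b))=b$ and $E_k(\iota_k(b)a\,\iota_k(b'))=bE_k(a)b'$, so that $\iota_k$ is injective; we regard $B$ as a subalgebra of $A_k$). No faithfulness of $E_k$ is assumed. Write $A_k^\circ=\ker E_k$ and $\{k,\overline k\}=\{1,2\}$. For a completely positive map $\varphi:C\to D$ between unital C*-algebras let $(K_\varphi,\rho_\varphi,\eta_\varphi)$ be its GNS construction: $K_\varphi$ is the right Hilbert $D$-module generated by vectors $\rho_\varphi(x)\eta_\varphi$ ($x\in C$) with $\langle\rho_\varphi(x)\eta_\varphi,\rho_\varphi(y)\eta_\varphi\rangle=\varphi(x^*y)$, and $C$ acts by $\rho_\varphi$. A family $(\varphi_j)_j$ of ucp (unital completely positive) maps on $C$ is \emph{GNS-faithful} if $\bigcap_j\ker\rho_{\varphi_j}=\{0\}$. Let $A_f$ be the full amalgamated free product of $A_1$ and $A_2$ over $B$, the universal unital C*-algebra generated by unital copies of $A_1$ and $A_2$ in which the two copies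 of $B$ coincide. An element $x\in A_f$ is \emph{reduced} if $x\neq0$ and $x=a_1\cdots a_n$ with $n\ge1$, $0\ne a_j\in A_{i_j}^\circ$ and $i_j\ne i_{j+1}$ for all $j$. Let $(K_k,\rho_k,\eta_k)$ be the GNS construction of $E_k$ and let $K_k^\circ$ be the closure of $\{\rho_k(a)\eta_k: a\in A_k^\circ\}$, so that $K_k=\eta_kB\oplus K_k^\circ$. For $k,l\in\{1,2\}$ let $$H_{k,l}=\bigoplus_{(i_1,\dots,i_n)} K_{i_1}\otimes_B K_{i_2}^\circ\otimes_B\cdots\otimes_B K_{i_{n-1}}^\circ\otimes_B A_{i_n},$$ the sum running over all $n\ge 1$ and alternating tuples in $\{1,2\}$ with $i_1=k$, $i_n=l$ (the summand is $A_l$ when $n=1$). It is a right Hilbert $A_l$-module, and $A_k$ acts on it by $\lambda_{k,l}$, through $\rho_k$ on the first tensor leg (by left multiplication when $n=1$). Let $u_{k,l}:H_{k,l}\to H_{\overline k,l}$ be the unitary with $u_{k,l}\xi=\eta_{\overline k}\otimes\xi$ for $\xi$ in the summand $n=1$ and $$u_{k,l}(\rho_k(x)\eta_k\otimes\xi')=\eta_{\overline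 k}\otimes\rho_k(x-E_k(x))\eta_k\otimes\xi'+\lambda_{\overline k,l}(E_k(x))\xi'$$ for $x\in A_k$ and $\xi'\in K_{i_2}^\circ\otimes_B\cdots\otimes_B A_{i_n}$, where $n\geq2$. Let $\pi_k:A_f\to\mathcal L_{A_k}(H_{k,k})$ be the unital $*$-homomorphism with $\pi_k(a)=\lambda_{k,k}(a)$ for $a\in A_k$ and $\pi_k(a)=u_{k,k}^*\lambda_{\overline k,k}(a)u_{k,k}$ for $a\in A_{\overline k}$. The \emph{vertex-reduced amalgamated free product} $A_v$ is the separation and completion of $A_f$ with respect to $\|x\|_v=\max(\|\pi_1(x)\|,\|\pi_2(x)\|)$, and $\pi:A_f\to A_v$ is the canonical $*$-homomorphism. \textbf{Proposition.} \begin{enumerate} \item $\pi$ is faithful on $A_k$ for $k=1,2$. \item For each $k\in\{1,2\}$ there is a unique ucp map $\mathbb E_{A_k}:A_v\to A_k$ such that $\mathbb E_{A_k}(\pi(a))=a$ for all $a\in A_k$ and $\mathbb E_{A_k}(\pi(a_1\cdots a_n))=0$ for every reduced $a_1\cdots a_n\in A_f$ with $n\ge2$, or with $n=1$ and $a_1\in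 A_{\overline k}^\circ$. Moreover, the family $\{\mathbb E_{A_1},\mathbb E_{A_2}\}$ is GNS-faithful. \item Let $C$ be a unital C*-algebra with faithful $*$-homomorphisms $\nu_k:A_k\to C$ ($k=1,2$) such that $\nu_1(b)=\nu_2(b)$ for all $b\in B$ and $C$ is generated, as a unital C*-algebra, by $\nu_1(A_1)\cup\nu_2(A_2)$. Suppose that for each $k$ there is a ucp map $E_{A_k}:C\to A_k$ with $E_{A_k}(\nu_k(a))=a$ for all $a\in A_k$ and $E_{A_k}(\nu_{i_1}(a_1)\cdots\nu_{i_n}(a_n))=0$ for every reduced $a_1\cdots a_n\in A_f$ with $a_j\in A_{i_j}^\circ$ and $n\ge2$, or with $n=1$ and $a_1\in A_{\overline k}^\circ$, and that the family $\{E_{A_1},E_{A_2}\}$ is GNS-faithful. Then there is a unique unital $*$-isomorphism $\nu:A_v\to C$ such that $\nu(\pi(a))=\nu_k(a)$ for all $a\in A_k$ and $k\in\{1,2\}$. Moreover, $E_{A_k}\circ\nu=\mathbb E_{A_k}$ for $k=1,2$. \end{enumerate} -/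

import Mathlib

open scoped CStarAlgebra
open MulOpposite

set_option linter.unusedSectionVars false

/-- The opposite of a C⋆-algebra is ordered by its positive cone. A right Hilbert `A`-module `E`
is an instance of `CStarModule Aᵐᵒᵖ E` on a complete space: there `⟪x, y • a⟫ = ⟪x, y⟫ a`. -/
instance MulOpposite.instStarOrderedRingCStar {A : Type*} [CStarAlgebra A] [PartialOrder A]
    [StarOrderedRing A] : StarOrderedRing Aᵐᵒᵖ :=
  StarOrderedRing.of_nonneg_iff' (fun {x y} h z => by
      change unop z + unop x ≤ unop z + unop y
      exact add_le_add_right (α := A) (unop_le_unop.mpr h) _)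
    (fun x => by
      rw [← unop_nonneg, CStarAlgebra.nonneg_iff_eq_mul_star_self]
      constructor
      · rintro ⟨b, hb⟩
        exact ⟨op b, by rw [← op_star, ← op_mul, ← hb, op_unop]⟩
      · rintro ⟨s, rfl⟩
        exact ⟨unop s, by simp⟩)

section Adjointable

variable (R E : Type*) [CStarAlgebra R] [PartialOrder R] [StarOrderedRing R]
  [NormedAddCommGroup E] [NormedSpace ℂ E] [SMul R E] [CStarModule R E]

variable {R E} in
theorem CStarModule.ext_inner {x y : E} (h : ∀ z : E, inner R z x = inner R z y) : x = y := by
  have h1 : inner R (x - y) (x - y) = 0 := by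
    rw [CStarModule.inner_sub_right, h, sub_self]
  exact sub_eq_zero.mp (CStarModule.inner_self.mp h1)

/-- The algebra `𝓛(E)` of adjointable operators of a Hilbert C⋆-module. -/
def Adjointable : Subalgebra ℂ (E →L[ℂ] E) where
  carrier := {T | ∃ S : E →L[ℂ] E, ∀ x y, inner R (T x) y = inner R x (S y)}
  mul_mem' := by
    rintro T T' ⟨S, h⟩ ⟨S', h'⟩
    exact ⟨S' * S, fun x y => by simp [h, h']⟩
  add_mem' := by
    rintro T T' ⟨S, h⟩ ⟨S', h'⟩
    exact ⟨S + S', fun x y => by simp [h, h']⟩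
  algebraMap_mem' c := ⟨algebraMap ℂ _ (star c), fun x y => by
    simp [Algebra.algebraMap_eq_smul_one]⟩

namespace Adjointable

variable {R E}

noncomputable instance : Star (Adjointable R E) where
  star T := ⟨T.2.choose, T.1, fun x y => by
    rw [← CStarModule.star_inner, ← T.2.choose_spec, CStarModule.star_inner]⟩

theorem inner_left (T : Adjointable R E) (x y : E) :
    inner R (T.1 x) y = inner R x ((star T).1 y) := T.2.choose_spec x y

theorem star_eq {T S : Adjointable R E} (h : ∀ x y, inner R (T.1 x) y = inner R x (S.1 y)) :
    star T = S := by
  refine Subtype.ext (ContinuousLinearMap.ext fun y => CStarModule.ext_inner (R := R) fun z => ?_)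
  rw [← inner_left, h]

noncomputable instance : StarRing (Adjointable R E) where
  star_involutive T := star_eq fun x y => by
    rw [← CStarModule.star_inner, ← inner_left, CStarModule.star_inner]
  star_mul T S := star_eq fun x y => by
    simp [inner_left]
  star_add T S := star_eq fun x y => by
    simp [inner_left]

instance : StarModule ℂ (Adjointable R E) where
  star_smul c T := star_eq fun x y => by
    simp [inner_left]

theorem norm_star_le (T : Adjointable R E) : ‖star T‖ ≤ ‖T‖ := by
  refine ContinuousLinearMap.opNorm_le_bound (star T).1 (norm_nonneg T.1) fun y => ?_
  have h : ‖(star T).1 y‖ * ‖(star T).1 y‖ ≤ (‖T.1‖ * ‖y‖) * ‖(star T).1 y‖ := by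
    rw [← pow_two, CStarModule.norm_sq_eq R, ← inner_left]
    refine (CStarModule.norm_inner_le E).trans ?_
    calc _ ≤ (‖T.1‖ * ‖(star T).1 y‖) * ‖y‖ := by gcongr; exact T.1.le_opNorm _
      _ = _ := by ring
  rcases (norm_nonneg ((star T).1 y)).eq_or_lt with h0 | h0
  · rw [← h0]; positivity
  · exact le_of_mul_le_mul_right h h0

instance : CStarRing (Adjointable R E) where
  norm_mul_self_le T := by
    have h : ‖T.1‖ ≤ √‖(star T * T).1‖ := by
      refine ContinuousLinearMap.opNorm_le_bound _ (Real.sqrt_nonneg _) fun x => ?_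
      refine abs_le_of_sq_le_sq' ?_ (by positivity) |>.2
      rw [CStarModule.norm_sq_eq R, inner_left, mul_pow, Real.sq_sqrt (norm_nonneg _)]
      refine (CStarModule.norm_inner_le E).trans ?_
      calc _ ≤ ‖x‖ * (‖(star T * T).1‖ * ‖x‖) := by
            gcongr; exact (star T * T).1.le_opNorm x
        _ = _ := by ring
    calc ‖T‖ * ‖T‖ ≤ √‖(star T * T).1‖ * √‖(star T * T).1‖ := by gcongr <;> exact h
      _ = _ := Real.mul_self_sqrt (norm_nonneg _)

noncomputable instance [CompleteSpace E] : CompleteSpace (Adjointable R E) := by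
  refine Metric.complete_of_cauchySeq_tendsto fun T hT => ?_
  have h1 : CauchySeq fun n => (T n).1 := hT.map uniformContinuous_subtype_val
  have h2 : CauchySeq fun n => (star (T n)).1 := by
    have : LipschitzWith 1 (star : Adjointable R E → Adjointable R E) :=
      LipschitzWith.of_dist_le_mul fun S S' => by
        rw [NNReal.coe_one, one_mul, dist_eq_norm, dist_eq_norm,
          show star S - star S' = star (S - S') from (star_sub S S').symm]
        exact norm_star_le (S - S')
    exact hT.map (uniformContinuous_subtype_val.comp this.uniformContinuous)
  obtain ⟨a, ha⟩ := cauchySeq_tendsto_of_complete h1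
  obtain ⟨b, hb⟩ := cauchySeq_tendsto_of_complete h2
  refine ⟨⟨a, b, fun x y => ?_⟩, tendsto_subtype_rng.mpr ha⟩
  have e1 : Filter.Tendsto (fun n => inner R ((T n).1 x) y) Filter.atTop (nhds (inner R (a x) y)) :=
    ((CStarModule.continuous_inner (A := R) (E := E)).comp
      (continuous_id.prodMk continuous_const)).continuousAt.tendsto.comp
      (((ContinuousLinearMap.apply ℂ E x).continuous.tendsto a).comp ha)
  have e2 : Filter.Tendsto (fun n => inner R x ((star (T n)).1 y)) Filter.atTop
      (nhds (inner R x (b y))) :=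
    ((CStarModule.continuous_inner (A := R) (E := E)).comp
      (continuous_const.prodMk continuous_id)).continuousAt.tendsto.comp
      (((ContinuousLinearMap.apply ℂ E y).continuous.tendsto b).comp hb)
  simp only [inner_left] at e1
  exact tendsto_nhds_unique e1 e2

noncomputable instance [CompleteSpace E] : CStarAlgebra (Adjointable R E) where

end Adjointable

end Adjointable

section PosKernel

variable {A : Type*} [CStarAlgebra A] [PartialOrder A] [StarOrderedRing A]

/-- A positive definite `A`-valued kernel on a set `X`. -/
structure PosKernel (A : Type*) [CStarAlgebra A] [PartialOrder A] [StarOrderedRing A]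
    (X : Type*) where
  toFun : X → X → A
  star_toFun : ∀ x y, star (toFun x y) = toFun y x
  nonneg : ∀ (s : Finset X) (a : X → A), 0 ≤ ∑ x ∈ s, ∑ y ∈ s, star (a x) * toFun x y * a y

namespace PosKernel

variable {X Y : Type*} (K : PosKernel A X) (L : PosKernel A Y)

/-- The free right `A`-module on `X`, to be equipped with the semi-inner product
`⟪x • a, y • b⟫ = a⋆ K(x, y) b`. -/
def Pre (_K : PosKernel A X) : Type _ := X →₀ A

noncomputable instance : AddCommGroup K.Pre := inferInstanceAs (AddCommGroup (X →₀ A))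
noncomputable instance : Module ℂ K.Pre := inferInstanceAs (Module ℂ (X →₀ A))
noncomputable instance : Module Aᵐᵒᵖ K.Pre := inferInstanceAs (Module Aᵐᵒᵖ (X →₀ A))
noncomputable instance : SMulCommClass ℂ Aᵐᵒᵖ K.Pre :=
  inferInstanceAs (SMulCommClass ℂ Aᵐᵒᵖ (X →₀ A))

/-- The element `x • a` of the free right module. -/
noncomputable def single (x : X) (a : A) : K.Pre := Finsupp.single x a

/-- The semi-inner product `⟪x • a, y • b⟫ = a⋆ K(x, y) b`. -/
noncomputable def form (f g : K.Pre) : A :=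
  Finsupp.sum (f : X →₀ A) fun x a => Finsupp.sum (g : X →₀ A) fun y b => star a * K.toFun x y * b

@[elab_as_elim]
theorem pre_induction {p : K.Pre → Prop} (h0 : p 0) (hs : ∀ x a, p (K.single x a))
    (ha : ∀ f g, p f → p g → p (f + g)) (f : K.Pre) : p f :=
  Finsupp.induction_linear (motive := p) f h0 ha hs

theorem form_add_left (f f' g : K.Pre) : K.form (f + f') g = K.form f g + K.form f' g := by
  unfold form
  refine Finsupp.sum_add_index' (fun x => ?_) fun x a b => ?_
  · simp [Finsupp.sum]
  · simp [Finsupp.sum, add_mul, Finset.sum_add_distrib]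

theorem form_add_right (f g g' : K.Pre) : K.form f (g + g') = K.form f g + K.form f g' := by
  unfold form
  refine Eq.trans (Finsupp.sum_congr (f := (f : X →₀ A)) fun x _ => ?_)
    (Finsupp.sum_add (f := (f : X →₀ A)))
  exact Finsupp.sum_add_index' (by simp) fun y a b => by simp [mul_add]

@[simp] theorem form_zero_left (g : K.Pre) : K.form 0 g = 0 := Finsupp.sum_zero_index

@[simp] theorem form_zero_right (f : K.Pre) : K.form f 0 = 0 := by
  have := K.form_add_right f 0 0
  simpa using this

@[simp] theorem form_single (x y : X) (a b : A) :
    K.form (K.single x a) (K.single y b) = star a * K.toFun x y * b := by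
  unfold form single
  rw [Finsupp.sum_single_index (by simp), Finsupp.sum_single_index (by simp)]

theorem smul_single (x : X) (a b : A) : op b • K.single x a = K.single x (a * b) :=
  Finsupp.smul_single _ _ _

theorem csmul_single (x : X) (a : A) (c : ℂ) : c • K.single x a = K.single x (c • a) :=
  Finsupp.smul_single _ _ _

theorem star_form (f g : K.Pre) : star (K.form f g) = K.form g f := by
  induction f using K.pre_induction with
  | h0 => simp
  | ha f f' h h' => rw [form_add_left, star_add, h, h', form_add_right]
  | hs x a =>
    induction g using K.pre_induction with
    | h0 => simp
    | ha f f' h h' => rw [form_add_right, star_add, h, h', form_add_left]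
    | hs y b => simp [K.star_toFun, mul_assoc]

theorem form_smul_right (f g : K.Pre) (a : A) : K.form f (op a • g) = K.form f g * a := by
  induction f using K.pre_induction with
  | h0 => simp
  | ha f f' h h' => rw [form_add_left, h, h', form_add_left, add_mul]
  | hs x b =>
    induction g using K.pre_induction with
    | h0 => simp
    | ha f f' h h' => rw [smul_add, form_add_right, h, h', form_add_right, add_mul]
    | hs y b => simp [smul_single, mul_assoc]

theorem form_smul_left (f g : K.Pre) (a : A) : K.form (op a • f) g = star a * K.form f g := by
  rw [← star_form, form_smul_right, star_mul, star_form]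

theorem form_csmul_right (f g : K.Pre) (c : ℂ) : K.form f (c • g) = c • K.form f g := by
  induction f using K.pre_induction with
  | h0 => simp
  | ha f f' h h' => rw [form_add_left, h, h', form_add_left, smul_add]
  | hs x b =>
    induction g using K.pre_induction with
    | h0 => simp
    | ha f f' h h' => rw [smul_add, form_add_right, h, h', form_add_right, smul_add]
    | hs y b => simp [csmul_single]

theorem form_csmul_left (f g : K.Pre) (c : ℂ) : K.form (c • f) g = star c • K.form f g := by
  rw [← star_form, form_csmul_right, star_smul, star_form]

theorem form_self_nonneg (f : K.Pre) : 0 ≤ K.form f f := K.nonneg _ _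

theorem norm_form_sq_le (f g : K.Pre) : ‖K.form f g‖ ^ 2 ≤ ‖K.form f f‖ * ‖K.form g g‖ := by
  suffices h : ∀ M : ℝ, ‖K.form f f‖ < M → ‖K.form f g‖ ^ 2 ≤ M * ‖K.form g g‖ by
    refine le_of_forall_pos_le_add fun ε hε => ?_
    have hpos : 0 < ‖K.form g g‖ + 1 := by positivity
    have := h (‖K.form f f‖ + ε / (‖K.form g g‖ + 1)) (by linarith [div_pos hε hpos])
    refine this.trans ?_
    rw [add_mul]
    gcongr
    rw [div_mul_eq_mul_div, div_le_iff₀ hpos]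
    nlinarith [norm_nonneg (K.form g g)]
  intro M hM
  have hM0 : 0 < M := (norm_nonneg _).trans_lt hM
  set c := K.form f g with hc
  have hc' : K.form g f = star c := by rw [hc, star_form]
  have h1 : 0 ≤ K.form (op c • f + (-M : ℂ) • g) (op c • f + (-M : ℂ) • g) :=
    K.form_self_nonneg _
  have h2 : star c * K.form f f * c ≤ ‖K.form f f‖ • (star c * c) :=
    CStarAlgebra.star_left_conjugate_le_norm_smul (hb := K.star_form f f)
  have h3 : K.form (op c • f + (-M : ℂ) • g) (op c • f + (-M : ℂ) • g) =
      star c * K.form f f * c - (2 * M) • (star c * c) + (M ^ 2) • K.form g g := by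
    simp only [form_add_left, form_add_right, form_smul_left, form_smul_right, form_csmul_left,
      form_csmul_right, ← hc, hc']
    have e : star (-M : ℂ) = -M := by simp
    rw [e]
    simp only [← Complex.coe_smul]
    push_cast
    rw [add_mul, smul_mul_assoc]
    module
  have h4 : M • (star c * c) ≤ (M ^ 2) • K.form g g := by
    have h5 : ‖K.form f f‖ • (star c * c) ≤ M • (star c * c) :=
      smul_le_smul_of_nonneg_right hM.le (star_mul_self_nonneg c)
    have h6 := h2.trans h5
    rw [h3] at h1
    rw [← sub_nonneg] at h6 ⊢
    have := add_nonneg h1 h6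
    convert this using 1
    module
  have h5 := CStarAlgebra.norm_le_norm_of_nonneg_of_le
    (smul_nonneg hM0.le (star_mul_self_nonneg c)) h4
  rw [norm_smul, norm_smul, CStarRing.norm_star_mul_self, Real.norm_of_nonneg hM0.le,
    Real.norm_of_nonneg (by positivity), pow_two M, mul_assoc] at h5
  rw [pow_two]
  exact le_of_mul_le_mul_left h5 hM0

noncomputable instance : Norm K.Pre := ⟨fun f => √‖K.form f f‖⟩

theorem norm_sq (f : K.Pre) : ‖f‖ ^ 2 = ‖K.form f f‖ := Real.sq_sqrt (norm_nonneg _)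

theorem norm_form_le (f g : K.Pre) : ‖K.form f g‖ ≤ ‖f‖ * ‖g‖ := by
  have h : ‖K.form f g‖ ^ 2 ≤ (‖f‖ * ‖g‖) ^ 2 := by
    rw [mul_pow, norm_sq, norm_sq]
    exact K.norm_form_sq_le f g
  exact abs_le_of_sq_le_sq' h (mul_nonneg (Real.sqrt_nonneg _) (Real.sqrt_nonneg _)) |>.2

theorem norm_pre_csmul (c : ℂ) (f : K.Pre) : ‖c • f‖ = ‖c‖ * ‖f‖ := by
  change √_ = _ * √_
  rw [form_csmul_right, form_csmul_left, norm_smul, norm_smul, norm_star, ← mul_assoc,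
    Real.sqrt_mul (by positivity), Real.sqrt_mul_self (norm_nonneg _)]

noncomputable instance : SeminormedAddCommGroup K.Pre :=
  SeminormedAddCommGroup.ofCore (𝕜 := ℂ)
    { norm_nonneg := fun f => Real.sqrt_nonneg _
      norm_smul := K.norm_pre_csmul
      norm_triangle := fun f g => by
        have h : ‖f + g‖ ^ 2 ≤ (‖f‖ + ‖g‖) ^ 2 := by
          rw [norm_sq, form_add_left, form_add_right, form_add_right, add_pow_two, norm_sq, norm_sq]
          have h1 := K.norm_form_le f g
          have h2 := K.norm_form_le g f
          have h3 := norm_add_le (K.form f f + K.form f g) (K.form g f + K.form g g)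
          have h4 := norm_add_le (K.form f f) (K.form f g)
          have h5 := norm_add_le (K.form g f) (K.form g g)
          linarith
        exact abs_le_of_sq_le_sq' h (add_nonneg (Real.sqrt_nonneg _) (Real.sqrt_nonneg _)) |>.2 }

noncomputable instance : NormedSpace ℂ K.Pre where
  norm_smul_le c f := (K.norm_pre_csmul c f).le

instance : UniformContinuousConstSMul Aᵐᵒᵖ K.Pre where
  uniformContinuous_const_smul a := by
    let T : K.Pre →+ K.Pre := DistribSMul.toAddMonoidHom K.Pre a
    refine (AddMonoidHomClass.lipschitz_of_bound T ‖unop a‖ fun f => ?_).uniformContinuous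
    have h : ‖op (unop a) • f‖ ^ 2 ≤ (‖unop a‖ * ‖f‖) ^ 2 := by
      rw [mul_pow, norm_sq, norm_sq, form_smul_left, form_smul_right, ← mul_assoc]
      refine (norm_mul_le _ _).trans ?_
      calc _ ≤ ‖unop a‖ * ‖K.form f f‖ * ‖unop a‖ := by
            gcongr; exact (norm_mul_le _ _).trans (by rw [norm_star])
        _ = _ := by ring
    exact abs_le_of_sq_le_sq' h (mul_nonneg (norm_nonneg _) (Real.sqrt_nonneg _)) |>.2

/-- The right Hilbert `A`-module of a positive definite kernel: separation and completion of the
free right module on `X`. -/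
def Hilb (K : PosKernel A X) : Type _ := UniformSpace.Completion K.Pre

noncomputable instance : NormedAddCommGroup K.Hilb :=
  inferInstanceAs (NormedAddCommGroup (UniformSpace.Completion K.Pre))
noncomputable instance : NormedSpace ℂ K.Hilb :=
  inferInstanceAs (NormedSpace ℂ (UniformSpace.Completion K.Pre))
noncomputable instance : Module Aᵐᵒᵖ K.Hilb :=
  inferInstanceAs (Module Aᵐᵒᵖ (UniformSpace.Completion K.Pre))
instance : CompleteSpace K.Hilb :=
  inferInstanceAs (CompleteSpace (UniformSpace.Completion K.Pre))
instance : ContinuousConstSMul Aᵐᵒᵖ K.Hilb :=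
  inferInstanceAs (ContinuousConstSMul Aᵐᵒᵖ (UniformSpace.Completion K.Pre))

/-- The canonical map into the completion. -/
noncomputable def toHilb : K.Pre →L[ℂ] K.Hilb := UniformSpace.Completion.toComplL

theorem denseRange_toHilb : DenseRange K.toHilb := UniformSpace.Completion.denseRange_coe

@[simp] theorem norm_toHilb (f : K.Pre) : ‖K.toHilb f‖ = ‖f‖ := UniformSpace.Completion.norm_coe f

theorem toHilb_smul (a : Aᵐᵒᵖ) (f : K.Pre) : K.toHilb (a • f) = a • K.toHilb f :=
  UniformSpace.Completion.coe_smul a f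

theorem isUniformInducing_toHilb : IsUniformInducing K.toHilb :=
  UniformSpace.Completion.isUniformInducing_coe K.Pre

/-- The extension by continuity of the semi-inner product. -/
noncomputable def innerSL : K.Hilb →L⋆[ℂ] K.Hilb →L[ℂ] A :=
  let I : K.Pre →L⋆[ℂ] K.Pre →L[ℂ] A := LinearMap.mkContinuous₂
    (LinearMap.mk₂'ₛₗ (starRingEnd ℂ) (RingHom.id ℂ) K.form K.form_add_left
      (fun c f g => K.form_csmul_left f g c) K.form_add_right
      (fun c f g => K.form_csmul_right f g c)) 1
    fun f g => by simpa using K.norm_form_le f g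
  ((I.extend K.toHilb).flip.extend K.toHilb).flip

@[simp] theorem innerSL_toHilb (f g : K.Pre) :
    K.innerSL (K.toHilb f) (K.toHilb g) = K.form f g := by
  unfold innerSL
  rw [ContinuousLinearMap.flip_apply,
    ContinuousLinearMap.extend_eq _ K.denseRange_toHilb K.isUniformInducing_toHilb,
    ContinuousLinearMap.flip_apply,
    ContinuousLinearMap.extend_eq _ K.denseRange_toHilb K.isUniformInducing_toHilb]
  rfl

theorem hilb_induction {p : K.Hilb → Prop} (hc : IsClosed {x | p x})
    (h : ∀ f, p (K.toHilb f)) (x : K.Hilb) : p x :=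
  K.denseRange_toHilb.induction_on x hc h

theorem continuous_innerSL {Z : Type*} [TopologicalSpace Z] {f g : Z → K.Hilb}
    (hf : Continuous f) (hg : Continuous g) : Continuous fun z => K.innerSL (f z) (g z) :=
  (K.innerSL.continuous.comp hf).clm_apply hg

theorem norm_hilb_sq (x : K.Hilb) : ‖x‖ ^ 2 = ‖K.innerSL x x‖ := by
  induction x using K.hilb_induction with
  | hc => exact isClosed_eq (by fun_prop) (K.continuous_innerSL continuous_id continuous_id).norm
  | h f => rw [norm_toHilb, norm_sq, innerSL_toHilb]

theorem innerSL_self_nonneg (x : K.Hilb) : 0 ≤ K.innerSL x x := by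
  induction x using K.hilb_induction with
  | hc => exact isClosed_Ici.preimage (K.continuous_innerSL continuous_id continuous_id)
  | h f => rw [innerSL_toHilb]; exact K.form_self_nonneg f

theorem innerSL_smul_right (a : Aᵐᵒᵖ) (x y : K.Hilb) :
    K.innerSL x (a • y) = K.innerSL x y * unop a := by
  induction x using K.hilb_induction with
  | hc => exact isClosed_eq (K.continuous_innerSL continuous_id continuous_const)
            ((K.continuous_innerSL continuous_id continuous_const).mul continuous_const)
  | h f =>
    induction y using K.hilb_induction with
    | hc => exact isClosed_eq (K.continuous_innerSL continuous_const (continuous_const_smul a))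
              ((K.continuous_innerSL continuous_const continuous_id).mul continuous_const)
    | h g => rw [← toHilb_smul, innerSL_toHilb, innerSL_toHilb, ← op_unop a, form_smul_right,
        op_unop]

theorem star_innerSL (x y : K.Hilb) : star (K.innerSL x y) = K.innerSL y x := by
  induction x using K.hilb_induction with
  | hc => exact isClosed_eq (K.continuous_innerSL continuous_id continuous_const).star
            (K.continuous_innerSL continuous_const continuous_id)
  | h f =>
    induction y using K.hilb_induction with
    | hc => exact isClosed_eq (K.continuous_innerSL continuous_const continuous_id).star
              (K.continuous_innerSL continuous_id continuous_const)
    | h g => rw [innerSL_toHilb, innerSL_toHilb, star_form]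

noncomputable instance : CStarModule Aᵐᵒᵖ K.Hilb where
  inner x y := op (K.innerSL x y)
  inner_add_right := by simp
  inner_self_nonneg := K.innerSL_self_nonneg _
  inner_self {x} := by
    rw [op_eq_zero_iff, ← norm_eq_zero, ← norm_hilb_sq]
    simp
  inner_op_smul_right {a x y} := congrArg op (K.innerSL_smul_right a x y)
  inner_smul_right_complex := by simp
  star_inner x y := congrArg op (K.star_innerSL x y)
  norm_eq_sqrt_norm_inner_self x := by
    rw [norm_op, ← norm_hilb_sq, Real.sqrt_sq (norm_nonneg _)]

theorem inner_toHilb (f g : K.Pre) :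
    inner Aᵐᵒᵖ (K.toHilb f) (K.toHilb g) = op (K.form f g) :=
  congrArg op (K.innerSL_toHilb f g)

end PosKernel

end PosKernel

section KernelMaps

namespace PosKernel

variable {A : Type*} [CStarAlgebra A] [PartialOrder A] [StarOrderedRing A]
variable {X Y : Type*} {K : PosKernel A X} {L : PosKernel A Y}

/-- The right `A`-linear map between free right modules with prescribed values on generators. -/
noncomputable def lift (τ : X → L.Pre) : K.Pre →ₗ[ℂ] L.Pre where
  toFun f := Finsupp.sum (f : X →₀ A) fun x a => op a • τ x
  map_add' f g := Finsupp.sum_add_index' (by simp) fun x a b => by rw [op_add, add_smul]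
  map_smul' c f := by
    refine Eq.trans (Finsupp.sum_smul_index' (g := (f : X →₀ A)) (by simp)) ?_
    refine Eq.trans ?_ (Finsupp.smul_sum (v := (f : X →₀ A))).symm
    refine Finsupp.sum_congr fun x _ => ?_
    rw [RingHom.id_apply, op_smul]
    generalize τ x = t
    induction t using L.pre_induction with
    | h0 => simp
    | ha s t hs ht => rw [smul_add, smul_add, smul_add, hs, ht]
    | hs y b => 
      rw [← op_smul, L.smul_single, L.smul_single, L.csmul_single, mul_smul_comm]

theorem lift_single (τ : X → L.Pre) (x : X) (a : A) :
    lift τ (K.single x a) = op a • τ x := by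
  change Finsupp.sum (Finsupp.single x a) (fun x a => op a • τ x) = _
  exact Finsupp.sum_single_index (by simp)

theorem lift_smul (τ : X → L.Pre) (a : A) (f : K.Pre) : lift τ (op a • f) = op a • lift τ f := by
  induction f using K.pre_induction with
  | h0 => simp
  | ha f g hf hg => simp only [smul_add, map_add, hf, hg]
  | hs x b => rw [smul_single, lift_single, lift_single, smul_smul, op_mul]

theorem single_eq (x : X) (a : A) : K.single x a = op a • K.single x 1 := by
  rw [smul_single, one_mul]

theorem form_lift {Z W : Type*} {M : PosKernel A Z} {N : PosKernel A W} {τ : X → L.Pre}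
    {σ : W → M.Pre} {p : W → L.Pre} {q : X → M.Pre}
    (h : ∀ x y, L.form (τ x) (p y) = M.form (q x) (σ y)) (f : K.Pre) (g : N.Pre) :
    L.form (lift τ f) (lift p g) = M.form (lift q f) (lift σ g) := by
  induction f using K.pre_induction with
  | h0 => simp
  | ha f f' h h' => simp only [map_add, form_add_left, h, h']
  | hs x a =>
    induction g using N.pre_induction with
    | h0 => simp
    | ha f f' h h' => simp only [map_add, form_add_right, h, h']
    | hs y b => simp only [lift_single, form_smul_left, form_smul_right, h]

theorem lift_self (f : K.Pre) : lift (fun x => K.single x 1) f = f := by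
  induction f using K.pre_induction with
  | h0 => simp
  | ha f f' h h' => rw [map_add, h, h']
  | hs x a => rw [lift_single, ← single_eq]

theorem form_lift_self {τ : X → L.Pre} {σ : Y → K.Pre}
    (h : ∀ x y, L.form (τ x) (L.single y 1) = K.form (K.single x 1) (σ y)) (f : K.Pre) (g : L.Pre) :
    L.form (lift τ f) g = K.form f (lift σ g) := by
  have := form_lift (K := K) (L := L) (M := K) (N := L) (τ := τ) (σ := σ) (p := fun y => L.single y 1)
    (q := fun x => K.single x 1) h f g
  rwa [lift_self, lift_self] at this

/-- The extension to the completions of a bounded linear map. -/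
noncomputable def extend (T : K.Pre →ₗ[ℂ] L.Pre) : K.Hilb →L[ℂ] L.Hilb :=
  ((L.toHilb : L.Pre →ₗ[ℂ] L.Hilb) ∘ₗ T).extendOfNorm (K.toHilb : K.Pre →ₗ[ℂ] K.Hilb)

theorem extend_toHilb {T : K.Pre →ₗ[ℂ] L.Pre} {C : ℝ} (h : ∀ f, ‖T f‖ ≤ C * ‖f‖) (f : K.Pre) :
    extend T (K.toHilb f) = L.toHilb (T f) :=
  LinearMap.extendOfNorm_eq (f := (L.toHilb : L.Pre →ₗ[ℂ] L.Hilb) ∘ₗ T)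
    (e := (K.toHilb : K.Pre →ₗ[ℂ] K.Hilb)) K.denseRange_toHilb
    ⟨C, fun f => by simpa using h f⟩ f

theorem hilb_ext {x y : K.Hilb}
    (h : ∀ f, K.innerSL (K.toHilb f) x = K.innerSL (K.toHilb f) y) : x = y := by
  refine CStarModule.ext_inner (R := Aᵐᵒᵖ) fun z => congrArg op ?_
  induction z using K.hilb_induction with
  | hc => exact isClosed_eq (K.continuous_innerSL continuous_id continuous_const)
            (K.continuous_innerSL continuous_id continuous_const)
  | h f => exact h f

theorem toHilb_eq_of_form {f g : K.Pre} (h : ∀ k, K.form k f = K.form k g) :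
    K.toHilb f = K.toHilb g :=
  hilb_ext fun k => by rw [innerSL_toHilb, innerSL_toHilb, h]

variable {R : Type*} [CStarAlgebra R] [PartialOrder R] [StarOrderedRing R]

/-- A left action of a C⋆-algebra on the generators of the Hilbert module of a kernel. -/
structure Action (R : Type*) [CStarAlgebra R] (K : PosKernel A X) where
  act : R → X → K.Pre
  act_one : ∀ x, act 1 x = K.single x 1
  form_act_add : ∀ a b x y, K.form (K.single x 1) (act (a + b) y) =
    K.form (K.single x 1) (act a y) + K.form (K.single x 1) (act b y)
  form_act_smul : ∀ (c : ℂ) a x y, K.form (K.single x 1) (act (c • a) y) =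
    c • K.form (K.single x 1) (act a y)
  form_act_act : ∀ a b x y,
    K.form (act a x) (act b y) = K.form (K.single x 1) (act (star a * b) y)

namespace Action

variable (S : Action R K)

theorem form_add (a b : R) (f g : K.Pre) : K.form f (lift (S.act (a + b)) g) =
    K.form f (lift (S.act a) g) + K.form f (lift (S.act b) g) := by
  induction f using K.pre_induction with
  | h0 => simp
  | ha f f' h h' => simp only [form_add_left, h, h']; abel
  | hs x c =>
    induction g using K.pre_induction with
    | h0 => simp
    | ha f f' h h' => simp only [map_add, form_add_right, h, h']; abel
    | hs y d =>
      rw [single_eq]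
      simp only [lift_single, form_smul_left, form_smul_right, S.form_act_add, add_mul, mul_add]

theorem form_smul (r : ℂ) (a : R) (f g : K.Pre) : K.form f (lift (S.act (r • a)) g) =
    r • K.form f (lift (S.act a) g) := by
  induction f using K.pre_induction with
  | h0 => simp
  | ha f f' h h' => simp only [form_add_left, h, h', smul_add]
  | hs x c =>
    induction g using K.pre_induction with
    | h0 => simp
    | ha f f' h h' => simp only [map_add, form_add_right, h, h', smul_add]
    | hs y d =>
      rw [single_eq]
      simp only [lift_single, form_smul_left, form_smul_right, S.form_act_smul, smul_mul_assoc,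
        mul_smul_comm]

theorem form_mul (a b : R) (f g : K.Pre) : K.form (lift (S.act a) f) (lift (S.act b) g) =
    K.form f (lift (S.act (star a * b)) g) := by
  have := form_lift (K := K) (L := K) (M := K) (N := K) (q := fun x => K.single x 1) (S.form_act_act a b) f g
  rwa [lift_self] at this

theorem lift_one (f : K.Pre) : lift (S.act 1) f = f := by
  rw [show S.act 1 = fun x => K.single x 1 from funext S.act_one, lift_self]

theorem form_left (a : R) (f g : K.Pre) : K.form (lift (S.act a) f) g =
    K.form f (lift (S.act (star a)) g) := by
  have := S.form_mul a 1 f g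
  rwa [lift_one, mul_one] at this

theorem norm_le (a : R) (f : K.Pre) : ‖lift (S.act a) f‖ ≤ ‖a‖ * ‖f‖ := by
  obtain ⟨c, hc⟩ := CStarAlgebra.nonneg_iff_eq_star_mul_self.mp
    (sub_nonneg.mpr (CStarAlgebra.star_mul_le_algebraMap_norm_sq (a := a)))
  have h1 : ‖a‖ ^ 2 • K.form f f = K.form (lift (S.act a) f) (lift (S.act a) f) +
      K.form (lift (S.act c) f) (lift (S.act c) f) := by
    rw [form_mul, form_mul, ← form_add, ← hc, add_sub_cancel, Algebra.algebraMap_eq_smul_one,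
      ← Complex.coe_smul, ← Complex.coe_smul, form_smul, lift_one]
  have h2 : K.form (lift (S.act a) f) (lift (S.act a) f) ≤ ‖a‖ ^ 2 • K.form f f := by
    rw [h1]; exact le_add_of_nonneg_right (K.form_self_nonneg _)
  have h3 := CStarAlgebra.norm_le_norm_of_nonneg_of_le (K.form_self_nonneg _) h2
  rw [norm_smul, Real.norm_of_nonneg (by positivity), ← norm_sq, ← norm_sq, ← mul_pow] at h3
  exact abs_le_of_sq_le_sq' h3 (by positivity) |>.2

/-- The operator by which `a` acts on the Hilbert module. -/
noncomputable def op (a : R) : K.Hilb →L[ℂ] K.Hilb := extend (lift (S.act a))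

theorem op_toHilb (a : R) (f : K.Pre) : S.op a (K.toHilb f) = K.toHilb (lift (S.act a) f) :=
  extend_toHilb (S.norm_le a) f

theorem op_ext {T T' : K.Hilb →L[ℂ] K.Hilb} (h : ∀ f, T (K.toHilb f) = T' (K.toHilb f)) : T = T' :=
  ContinuousLinearMap.coeFn_injective
    (K.denseRange_toHilb.equalizer T.continuous T'.continuous (funext h))

theorem inner_op (a : R) (x y : K.Hilb) :
    inner Aᵐᵒᵖ (S.op a x) y = inner Aᵐᵒᵖ x (S.op (star a) y) := by
  refine congrArg MulOpposite.op ?_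
  induction x using K.hilb_induction with
  | hc => exact isClosed_eq (K.continuous_innerSL (S.op a).continuous continuous_const)
            (K.continuous_innerSL continuous_id continuous_const)
  | h f =>
    induction y using K.hilb_induction with
    | hc => exact isClosed_eq (K.continuous_innerSL continuous_const continuous_id)
              (K.continuous_innerSL continuous_const (S.op (star a)).continuous)
    | h g => rw [op_toHilb, op_toHilb, innerSL_toHilb, innerSL_toHilb, form_left]

/-- The unital `⋆`-homomorphism `R → 𝓛(K.Hilb)` determined by an action on generators. -/
noncomputable def rep : R →⋆ₐ[ℂ] Adjointable Aᵐᵒᵖ K.Hilb where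
  toFun a := ⟨S.op a, S.op (star a), S.inner_op a⟩
  map_one' := Subtype.ext <| op_ext fun f => by
    change S.op 1 _ = K.toHilb f
    rw [op_toHilb, lift_one]
  map_mul' a b := Subtype.ext <| op_ext fun f => by
    change S.op _ _ = S.op a (S.op b _)
    simp only [op_toHilb]
    refine toHilb_eq_of_form fun k => ?_
    have h := S.form_left (star a) k (lift (S.act b) f)
    rw [star_star] at h
    rw [← h, form_mul, star_star]
  map_zero' := Subtype.ext <| op_ext fun f => by
    change S.op _ _ = 0
    rw [op_toHilb, ← map_zero K.toHilb]
    refine toHilb_eq_of_form fun k => ?_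
    have := S.form_smul 0 0 k f
    rw [zero_smul, zero_smul] at this
    rw [this, form_zero_right]
  map_add' a b := Subtype.ext <| op_ext fun f => by
    change S.op _ _ = S.op a _ + S.op b _
    simp only [op_toHilb]
    rw [← map_add]
    refine toHilb_eq_of_form fun k => ?_
    rw [form_add_right, form_add]
  commutes' r := Subtype.ext <| op_ext fun f => by
    change S.op _ _ = r • K.toHilb f
    rw [op_toHilb, ← map_smul]
    refine toHilb_eq_of_form fun k => ?_
    rw [Algebra.algebraMap_eq_smul_one, form_smul, lift_one, form_csmul_right]
  map_star' a := (Adjointable.star_eq (S.inner_op a)).symm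

end Action

end PosKernel

/-- A unitary between Hilbert C⋆-modules: a bijective map preserving inner products
(equivalently, an adjointable operator whose adjoint is its inverse). -/
structure HilbertUnitary (R E F : Type*) [CStarAlgebra R] [PartialOrder R] [StarOrderedRing R]
    [NormedAddCommGroup E] [NormedSpace ℂ E] [SMul R E] [CStarModule R E]
    [NormedAddCommGroup F] [NormedSpace ℂ F] [SMul R F] [CStarModule R F] where
  equiv : E ≃L[ℂ] F
  inner_map : ∀ x y, inner R (equiv x) (equiv y) = inner R x y

/-- The `⋆`-homomorphism `T ↦ u⋆ T u`. -/
def HilbertUnitary.conj {R E F : Type*} [CStarAlgebra R] [PartialOrder R] [StarOrderedRing R]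
    [NormedAddCommGroup E] [NormedSpace ℂ E] [SMul R E] [CStarModule R E]
    [NormedAddCommGroup F] [NormedSpace ℂ F] [SMul R F] [CStarModule R F]
    (u : HilbertUnitary R E F) : Adjointable R F →⋆ₐ[ℂ] Adjointable R E :=
  have key (T : Adjointable R F) (x y : E) :
      inner R (u.equiv.symm (T.1 (u.equiv x))) y =
        inner R x (u.equiv.symm ((star T).1 (u.equiv y))) := by
    rw [← u.inner_map, ← u.inner_map x]
    simp [Adjointable.inner_left]
  { toFun := fun T =>
      ⟨(u.equiv.symm : F →L[ℂ] E) ∘L T.1 ∘L (u.equiv : E →L[ℂ] F),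
        (u.equiv.symm : F →L[ℂ] E) ∘L (star T).1 ∘L (u.equiv : E →L[ℂ] F), key T⟩
    map_one' := Subtype.ext <| ContinuousLinearMap.ext fun x => by simp
    map_mul' := fun S T => Subtype.ext <| ContinuousLinearMap.ext fun x => by simp
    map_zero' := Subtype.ext <| ContinuousLinearMap.ext fun x => by simp
    map_add' := fun S T => Subtype.ext <| ContinuousLinearMap.ext fun x => by simp
    commutes' := fun c => Subtype.ext <| ContinuousLinearMap.ext fun x => by
      simp [Algebra.algebraMap_eq_smul_one]
    map_star' := fun T => (Adjointable.star_eq (key T)).symm }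

end KernelMaps

section GNS

namespace CStarMatrix

variable {A : Type*} [CStarAlgebra A] [PartialOrder A] [StarOrderedRing A]
  {n : Type*} [Fintype n]

/-- The matrix with prescribed entries. -/
def entries (M : n → n → A) : CStarMatrix n n A := ofMatrix (Matrix.of M)

@[simp] theorem entries_apply (M : n → n → A) (i j : n) : entries M i j = M i j := rfl

theorem quadratic_nonneg {M : CStarMatrix n n A} (hM : 0 ≤ M) (a : n → A) :
    0 ≤ ∑ i, ∑ j, star (a i) * M i j * a j := by
  rw [StarOrderedRing.nonneg_iff] at hM
  induction hM using AddSubmonoid.closure_induction with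
  | zero => simp
  | add M N _ _ hM hN =>
    simp only [add_apply, mul_add, add_mul, Finset.sum_add_distrib]
    exact add_nonneg hM hN
  | mem M h =>
    obtain ⟨N, rfl⟩ := h
    have h : ∑ i, ∑ j, star (a i) * (star N * N) i j * a j =
        ∑ k, star (∑ i, N k i * a i) * (∑ j, N k j * a j) := by
      simp only [CStarMatrix.mul_apply, star_apply, star_sum, star_mul, Finset.sum_mul,
        Finset.mul_sum, mul_assoc]
      calc _ = ∑ i, ∑ k, ∑ j, star (a i) * (star (N k i) * (N k j * a j)) :=
            Finset.sum_congr rfl fun i _ => Finset.sum_comm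
        _ = ∑ k, ∑ i, ∑ j, star (a i) * (star (N k i) * (N k j * a j)) := Finset.sum_comm
        _ = _ := Finset.sum_congr rfl fun k _ => Finset.sum_comm
    change 0 ≤ ∑ i, ∑ j, star (a i) * (star N * N) i j * a j
    rw [h]
    exact Finset.sum_nonneg fun k _ => star_mul_self_nonneg _

theorem conj_nonneg {M : CStarMatrix n n A} (hM : 0 ≤ M) (c : n → A) :
    0 ≤ (entries fun i j => star (c i) * M i j * c j : CStarMatrix n n A) := by
  classical
  have h := star_left_conjugate_nonneg hM (entries fun i j => if i = j then c i else 0)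
  convert h using 1
  ext i j
  simp [CStarMatrix.mul_apply, star_apply, ite_mul, apply_ite star]

theorem const_nonneg : 0 ≤ (entries fun _ _ => 1 : CStarMatrix n n A) := by
  rcases isEmpty_or_nonempty n with h | ⟨⟨i₀⟩⟩
  · exact le_of_eq (by ext i; exact h.elim i)
  classical
  have h := star_mul_self_nonneg
    (entries fun i _ => if i = i₀ then 1 else 0 : CStarMatrix n n A)
  convert h using 1
  ext i j
  simp [CStarMatrix.mul_apply, star_apply]

theorem gram_nonneg (c : n → A) :
    0 ≤ (entries fun i j => star (c i) * c j : CStarMatrix n n A) := by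
  convert conj_nonneg const_nonneg c using 1
  ext i j
  simp

end CStarMatrix

variable {A C : Type*} [CStarAlgebra A] [PartialOrder A] [StarOrderedRing A]
  [CStarAlgebra C] [PartialOrder C] [StarOrderedRing C]

theorem PosKernel.sum_nonneg {X : Type*} {k : X → X → A}
    (h : ∀ s : Finset X, 0 ≤ (CStarMatrix.entries fun i j : s => k i j : CStarMatrix s s A))
    (s : Finset X) (a : X → A) : 0 ≤ ∑ x ∈ s, ∑ y ∈ s, star (a x) * k x y * a y := by
  have := CStarMatrix.quadratic_nonneg (h s) fun i => a i
  simp only [CStarMatrix.entries_apply] at this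
  rw [← Finset.sum_coe_sort s]
  simp only [← Finset.sum_coe_sort s]
  exact this

/-- The kernel `(x, y) ↦ φ(x⋆ y)` of a completely positive map. -/
noncomputable def gnsKernel (φ : C →CP A) : PosKernel A C where
  toFun x y := φ (star x * y)
  star_toFun x y := by rw [← map_star]; simp
  nonneg := PosKernel.sum_nonneg fun s =>
    φ.map_cstarMatrix_nonneg _ (CStarMatrix.gram_nonneg fun i : s => (i : C))

/-- Left multiplication on the generators of the GNS module. -/
noncomputable def gnsAction (φ : C →CP A) : (gnsKernel φ).Action C where
  act c x := (gnsKernel φ).single (c * x) 1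
  act_one x := by rw [one_mul]
  form_act_add a b x y := by simp [gnsKernel, add_mul, mul_add]
  form_act_smul c a x y := by simp [gnsKernel]
  form_act_act a b x y := by simp [gnsKernel, mul_assoc]

/-- The GNS representation `C → 𝓛(K)` of a completely positive map `φ : C → A`; here `K` is the
Hilbert module spanned by vectors `ρ(x)η` with `⟪ρ(x)η, ρ(y)η⟫ = φ(x⋆ y)`. -/
noncomputable def gnsRep (φ : C →CP A) : C →⋆ₐ[ℂ] Adjointable Aᵐᵒᵖ (gnsKernel φ).Hilb :=
  (gnsAction φ).rep

/-- A family of completely positive maps is GNS-faithful if the kernels of its GNS representations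
intersect trivially. -/
def GNSFaithful {J : Type*} {D : J → Type*} [∀ j, CStarAlgebra (D j)] [∀ j, PartialOrder (D j)]
    [∀ j, StarOrderedRing (D j)] (φ : ∀ j, C →CP D j) : Prop :=
  ∀ c : C, (∀ j, gnsRep (φ j) c = 0) → c = 0

end GNS

universe u v w

/-- A conditional expectation for a unital inclusion `ι : B → A` of C⋆-algebras: a completely
positive `B`-bimodule projection of `A` onto `B`. (The existence of one forces `ι` to be
injective, and such a map is unital.) -/
structure CondExp {A : Type u} {B : Type v} [CStarAlgebra A] [PartialOrder A] [StarOrderedRing A]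
    [CStarAlgebra B] [PartialOrder B] [StarOrderedRing B] (ι : B →⋆ₐ[ℂ] A) where
  toCP : A →CP B
  map_incl : ∀ b, toCP (ι b) = b
  map_bimodule : ∀ b a b', toCP (ι b * a * ι b') = b * toCP a * b'

noncomputable instance {A : Type u} {B : Type v} [CStarAlgebra A] [PartialOrder A] [StarOrderedRing A]
    [CStarAlgebra B] [PartialOrder B] [StarOrderedRing B] (ι : B →⋆ₐ[ℂ] A) :
    CoeFun (CondExp ι) fun _ => A → B := ⟨fun E => E.toCP⟩

section Words

variable {A : Fin 2 → Type u} [∀ k, CStarAlgebra (A k)] [∀ k, PartialOrder (A k)]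
  [∀ k, StarOrderedRing (A k)] {B : Type v} [CStarAlgebra B] [PartialOrder B] [StarOrderedRing B]
  {ι : ∀ k, B →⋆ₐ[ℂ] A k} (E : ∀ k, CondExp (ι k))

/-- `⟪ρ(x)η, b · ρ(y)η⟫` in the GNS modules of the conditional expectations; GNS vectors belonging
to different vertices do not interact. -/
noncomputable def letterForm (b : B) (x y : Σ k, A k) : B :=
  if h : y.1 = x.1 then E x.1 (star x.2 * ι x.1 b * (h ▸ y.2)) else 0

/-- The `B`-valued form `⟪x₁ ⊗ ⋯ ⊗ xₙ, b · (y₁ ⊗ ⋯ ⊗ yₙ)⟫` on elementary tensors, given by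
`⟪x ⊗ w, b · (y ⊗ w')⟫ = ⟪w, ⟪x, b · y⟫ · w'⟫`; tensors of different types are orthogonal. -/
noncomputable def wordForm : B → List (Σ k, A k) → List (Σ k, A k) → B
  | b, [], [] => b
  | b, x :: w, y :: w' => wordForm (letterForm E b x y) w w'
  | _, _, _ => 0

@[simp] theorem letterForm_same (b : B) (k : Fin 2) (x y : A k) :
    letterForm E b ⟨k, x⟩ ⟨k, y⟩ = E k (star x * ι k b * y) := by
  simp [letterForm]

theorem letterForm_ne (b : B) {j k : Fin 2} (h : j ≠ k) (x : A j) (y : A k) :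
    letterForm E b ⟨j, x⟩ ⟨k, y⟩ = 0 := by
  simp [letterForm, h.symm]

theorem letterForm_add (b b' : B) (x y : Σ k, A k) :
    letterForm E (b + b') x y = letterForm E b x y + letterForm E b' x y := by
  obtain ⟨j, x⟩ := x
  obtain ⟨k, y⟩ := y
  by_cases h : j = k
  · subst h; simp [mul_add, add_mul]
  · simp [letterForm_ne E _ h]

theorem letterForm_smul (c : ℂ) (b : B) (x y : Σ k, A k) :
    letterForm E (c • b) x y = c • letterForm E b x y := by
  obtain ⟨j, x⟩ := x
  obtain ⟨k, y⟩ := y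
  by_cases h : j = k
  · subst h; simp
  · simp [letterForm_ne E _ h]

theorem star_letterForm (b : B) (x y : Σ k, A k) :
    star (letterForm E b x y) = letterForm E (star b) y x := by
  obtain ⟨j, x⟩ := x
  obtain ⟨k, y⟩ := y
  by_cases h : j = k
  · subst h
    rw [letterForm_same, letterForm_same, ← map_star]
    simp [mul_assoc, map_star]
  · simp [letterForm_ne E _ h, letterForm_ne E _ (Ne.symm h)]

theorem wordForm_add (b b' : B) (w w' : List (Σ k, A k)) :
    wordForm E (b + b') w w' = wordForm E b w w' + wordForm E b' w w' := by
  induction w generalizing b b' w' with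
  | nil => cases w' <;> simp [wordForm]
  | cons x w ih => cases w' <;> simp [wordForm, letterForm_add, ih]

theorem wordForm_smul (c : ℂ) (b : B) (w w' : List (Σ k, A k)) :
    wordForm E (c • b) w w' = c • wordForm E b w w' := by
  induction w generalizing b w' with
  | nil => cases w' <;> simp [wordForm]
  | cons x w ih => cases w' <;> simp [wordForm, letterForm_smul, ih]

@[simp] theorem wordForm_zero (w w' : List (Σ k, A k)) : wordForm E 0 w w' = 0 := by
  simpa using wordForm_smul E 0 0 w w'

theorem star_wordForm (b : B) (w w' : List (Σ k, A k)) :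
    star (wordForm E b w w') = wordForm E (star b) w' w := by
  induction w generalizing b w' with
  | nil => cases w' <;> simp [wordForm]
  | cons x w ih => cases w' <;> simp [wordForm, star_letterForm, ih]

/-- The `k`-component of a letter. -/
def letterComp (k : Fin 2) (x : Σ k, A k) : A k := if h : x.1 = k then h ▸ x.2 else 0

theorem letterForm_eq_sum (b : B) (x y : Σ k, A k) :
    letterForm E b x y = ∑ k, E k (star (letterComp k x) * ι k b * letterComp k y) := by
  obtain ⟨i, x⟩ := x
  obtain ⟨j, y⟩ := y
  fin_cases i <;> fin_cases j <;> simp [letterForm, letterComp]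

theorem wordForm_nonneg {n : Type*} [Fintype n] (m : n → n → B)
    (hm : 0 ≤ CStarMatrix.entries m) (w : n → List (Σ k, A k)) :
    0 ≤ CStarMatrix.entries fun i j => wordForm E (m i j) (w i) (w j) := by
  suffices h : ∀ N : ℕ, ∀ (m : n → n → B) (_ : 0 ≤ CStarMatrix.entries m)
      (w : n → List (Σ k, A k)), (∀ i, (w i).length ≤ N) →
      0 ≤ CStarMatrix.entries fun i j => wordForm E (m i j) (w i) (w j) by
    refine h (∑ i, (w i).length) m hm w fun i => ?_
    exact Finset.single_le_sum (f := fun i => (w i).length) (fun _ _ => Nat.zero_le _)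
      (Finset.mem_univ i)
  intro N
  induction N with
  | zero =>
    intro m hm w hw
    have : ∀ i, w i = [] := fun i => List.length_eq_zero_iff.mp (Nat.le_zero.mp (hw i))
    simpa [this, wordForm] using hm
  | succ N ih =>
    intro m hm w hw
    classical
    let p : n → B := fun i => if w i = [] then 1 else 0
    let d : ∀ k, n → A k := fun k i => (w i).head?.elim 0 (letterComp k)
    let m' : n → n → B := fun i j => ∑ k, E k (star (d k i) * ι k (m i j) * d k j)
    have h1 : 0 ≤ CStarMatrix.entries fun i j => star (p i) * m i j * p j :=
      CStarMatrix.conj_nonneg hm p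
    have h2 : 0 ≤ CStarMatrix.entries m' := by
      have e : CStarMatrix.entries m' = ∑ k, CStarMatrix.entries fun i j =>
          E k (star (d k i) * ι k (m i j) * d k j) := by
        ext i j
        simp [m']
      rw [e]
      refine Finset.sum_nonneg fun k _ => ?_
      have h3 : 0 ≤ CStarMatrix.entries fun i j => ι k (m i j) :=
        CompletelyPositiveMap.map_cstarMatrix_nonneg (ι k : B →CP A k) _ hm
      exact (E k).toCP.map_cstarMatrix_nonneg _ (CStarMatrix.conj_nonneg h3 (d k))
    have h3 := ih m' h2 (fun i => (w i).tail) fun i => by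
      have := hw i
      rw [List.length_tail]; omega
    convert add_nonneg h1 h3 using 1
    ext i j
    simp only [CStarMatrix.entries_apply, CStarMatrix.add_apply]
    rcases hi : w i with _ | ⟨x, t⟩ <;> rcases hj : w j with _ | ⟨y, t'⟩ <;>
      simp [p, m', d, hi, hj, wordForm, letterForm_eq_sum]

end Words

section VertexModules

variable {A : Fin 2 → Type u} [∀ k, CStarAlgebra (A k)] [∀ k, PartialOrder (A k)]
  [∀ k, StarOrderedRing (A k)] {B : Type v} [CStarAlgebra B] [PartialOrder B] [StarOrderedRing B]
  {ι : ∀ k, B →⋆ₐ[ℂ] A k} (E : ∀ k, CondExp (ι k))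

/-- Elementary tensors `x₂ ⊗ ⋯ ⊗ xₙ₋₁` of centred letters (the kernels of the conditional
expectations) which may stand between a letter of type `k` and a last letter of type `l`. -/
structure Middle (k l : Fin 2) where
  list : List (Σ k, A k)
  chain : (k :: (list.map Sigma.fst ++ [l])).IsChain (· ≠ ·)
  centred : ∀ x ∈ list, E x.1 x.2 = 0

/-- The generators of the right `A l`-module `H_{k,l}`: for `n = 1` (and `k = l`) the unit vector
of the summand `A l`; for `n ≥ 2` the elementary tensors `ρ(x₁)η ⊗ ρ(x₂)η ⊗ ⋯ ⊗ ρ(xₙ₋₁)η ⊗ 1`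
with `x₁ ∈ A k` and `x₂, …, xₙ₋₁` centred. -/
inductive Elem : Fin 2 → Fin 2 → Type u
  | nil (l : Fin 2) : Elem l l
  | cons {k l : Fin 2} (x : A k) (t : Middle E k l) : Elem k l

namespace Elem

variable {E}

/-- The letters of an elementary tensor, without the last one. -/
def toList : ∀ {k l : Fin 2}, Elem E k l → List (Σ k, A k)
  | _, _, nil _ => []
  | k, _, cons x t => ⟨k, x⟩ :: t.list

theorem fin_two_eq : ∀ {j k k' : Fin 2}, k ≠ k' → k ≠ j → j = k' := by decide

/-- The inclusion of `K°_{i₂} ⊗ ⋯ ⊗ A l` in `K_{i₂} ⊗ ⋯ ⊗ A l`, on elementary tensors. -/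
def ofMiddle {k k' l : Fin 2} (h : k ≠ k') : Middle E k l → Elem E k' l
  | ⟨[], hc, _⟩ =>
    have e : l = k' := fin_two_eq h (by simpa using hc)
    e ▸ nil l
  | ⟨⟨j, y⟩ :: s, hc, hz⟩ =>
    have e : j = k' := fin_two_eq h (by simp at hc; exact hc.1)
    e ▸ cons y ⟨s, by simp at hc ⊢; exact hc.2, fun x hx => hz x (List.mem_cons_of_mem _ hx)⟩

@[simp] theorem toList_ofMiddle {k k' l : Fin 2} (h : k ≠ k') (t : Middle E k l) :
    (ofMiddle h t).toList = t.list := by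
  obtain ⟨_ | ⟨⟨j, y⟩, s⟩, hc, hz⟩ := t
  · have e : l = k' := fin_two_eq h (by simpa using hc)
    subst e
    rfl
  · have e : j = k' := fin_two_eq h (by simp at hc; exact hc.1)
    subst e
    rfl

end Elem

/-- The `A l`-valued inner products of the generators of `H_{k,l}`. -/
noncomputable def vertexKernel (k l : Fin 2) : PosKernel (A l) (Elem E k l) where
  toFun v w := ι l (wordForm E 1 v.toList w.toList)
  star_toFun v w := by rw [← map_star, star_wordForm, star_one]
  nonneg := PosKernel.sum_nonneg fun s =>
    CompletelyPositiveMap.map_cstarMatrix_nonneg (ι l : B →CP A l) _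
      (wordForm_nonneg E (fun _ _ => 1) CStarMatrix.const_nonneg fun i : s => i.1.toList)

/-- The `A k`-`A l`-bimodule `H_{k,l} = ⨁ K_{i₁} ⊗_B K°_{i₂} ⊗_B ⋯ ⊗_B K°_{iₙ₋₁} ⊗_B A_{iₙ}`, the sum
being over all alternating `(i₁, …, iₙ)` with `i₁ = k` and `iₙ = l`, as a right Hilbert
`A l`-module: the separated completion of the algebraic direct sum of algebraic tensor products. -/
abbrev VertexModule (k l : Fin 2) : Type u := (vertexKernel E k l).Hilb

variable {E}

@[simp] theorem vertexKernel_toFun {k l : Fin 2} (v w : Elem E k l) :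
    (vertexKernel E k l).toFun v w = ι l (wordForm E 1 v.toList w.toList) := rfl

@[simp] theorem toList_nil (l : Fin 2) : (Elem.nil l : Elem E l l).toList = [] := rfl

@[simp] theorem toList_cons {k l : Fin 2} (x : A k) (t : Middle E k l) :
    (Elem.cons x t).toList = ⟨k, x⟩ :: t.list := rfl

/-- Left multiplication by `A k` on the generators of `H_{k,l}`. -/
noncomputable def leftMul {k l : Fin 2} (a : A k) (v : Elem E k l) : (vertexKernel E k l).Pre :=
  match k, l, v, a with
  | _, _, .nil l, a => (vertexKernel E l l).single (.nil l) a
  | k, l, .cons x t, a => (vertexKernel E k l).single (.cons (a * x) t) 1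

@[simp] theorem leftMul_nil {l : Fin 2} (a : A l) :
    leftMul a (Elem.nil l : Elem E l l) = (vertexKernel E l l).single (.nil l) a := rfl

@[simp] theorem leftMul_cons {k l : Fin 2} (a x : A k) (t : Middle E k l) :
    leftMul a (Elem.cons x t) = (vertexKernel E k l).single (.cons (a * x) t) 1 := rfl

theorem form_single_leftMul {k l : Fin 2} (b : B) (v w : Elem E k l) :
    (vertexKernel E k l).form ((vertexKernel E k l).single v 1) (leftMul (ι k b) w) =
      ι l (wordForm E b v.toList w.toList) := by
  cases w <;> cases v <;> simp [wordForm, ← mul_assoc]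

variable (E) in
/-- The left action `λ_{k,l}` of `A k` on `H_{k,l}`, on generators. -/
noncomputable def leftAction (k l : Fin 2) : (vertexKernel E k l).Action (A k) where
  act := leftMul
  act_one v := by cases v <;> simp
  form_act_add a b v w := by
    cases w <;> cases v <;> simp [wordForm, add_mul, mul_add, wordForm_add]
  form_act_smul c a v w := by
    cases w <;> cases v <;> simp [wordForm, wordForm_smul]
  form_act_act a b v w := by
    cases w <;> cases v <;> simp [wordForm, mul_assoc]

variable (E) in
/-- The representation `λ_{k,l} : A k → 𝓛(H_{k,l})`. -/
noncomputable def leftRep (k l : Fin 2) : A k →⋆ₐ[ℂ] Adjointable (A l)ᵐᵒᵖ (VertexModule E k l) :=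
  (leftAction E k l).rep

theorem form_leftMul_leftMul {k l : Fin 2} (b c : B) (v w : Elem E k l) :
    (vertexKernel E k l).form (leftMul (ι k b) v) (leftMul (ι k c) w) =
      ι l (wordForm E (star b * c) v.toList w.toList) := by
  rw [← form_single_leftMul, map_mul, map_star]
  exact (leftAction E k l).form_act_act _ _ v w

/-- The tensor `η ⊗ ρ(x - E x)η ⊗ t`. -/
noncomputable def padded {k k' l : Fin 2} (h : k ≠ k') (x : A k) (t : Middle E k l) :
    Elem E k' l :=
  .cons 1 ⟨⟨k, x - ι k (E k x)⟩ :: t.list, by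
      rw [List.map_cons, List.cons_append, List.isChain_cons_cons]
      exact ⟨h.symm, t.chain⟩, by
    intro y hy
    rcases List.mem_cons.mp hy with rfl | hy
    · simp [(E k).map_incl]
    · exact t.centred y hy⟩

/-- The unitary `u_{k,l} : H_{k,l} → H_{k',l}` on generators, `{k, k'} = {1, 2}`:
`ξ ↦ η ⊗ ξ` for `n = 1`, and for `n ≥ 2`
`ρ(x)η ⊗ ξ' ↦ η ⊗ ρ(x - E x)η ⊗ ξ' + λ(E x) ξ'`. -/
noncomputable def vertexFlip {k k' l : Fin 2} (h : k ≠ k') (v : Elem E k l) :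
    (vertexKernel E k' l).Pre :=
  match k, l, v, h with
  | _, _, .nil l, h =>
    (vertexKernel E k' l).single (.cons 1 ⟨[], by simpa using h.symm, by simp⟩) 1
  | k, l, .cons x t, h =>
    (vertexKernel E k' l).single (padded h x t) 1 + leftMul (ι k' (E k x)) (Elem.ofMiddle h t)

@[simp] theorem vertexFlip_nil {k' l : Fin 2} (h : l ≠ k') :
    vertexFlip h (Elem.nil l : Elem E l l) =
      (vertexKernel E k' l).single (.cons 1 ⟨[], by simpa using h.symm, by simp⟩) 1 := rfl

@[simp] theorem vertexFlip_cons {k k' l : Fin 2} (h : k ≠ k') (x : A k) (t : Middle E k l) :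
    vertexFlip h (Elem.cons x t) = (vertexKernel E k' l).single (padded h x t) 1 +
      leftMul (ι k' (E k x)) (Elem.ofMiddle h t) := rfl

@[simp] theorem toList_padded {k k' l : Fin 2} (h : k ≠ k') (x : A k) (t : Middle E k l) :
    (padded h x t).toList = ⟨k', 1⟩ :: ⟨k, x - ι k (E k x)⟩ :: t.list := rfl

theorem CondExp.apply_mul_incl (k : Fin 2) (a : A k) (b : B) : E k (a * ι k b) = E k a * b := by
  simpa using (E k).map_bimodule 1 a b

theorem CondExp.apply_incl_mul (k : Fin 2) (a : A k) (b : B) : E k (ι k b * a) = b * E k a := by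
  simpa using (E k).map_bimodule b a 1

theorem CondExp.apply_star (k : Fin 2) (a : A k) : E k (star a) = star (E k a) := map_star _ _

theorem CondExp.apply_centred (k : Fin 2) (x y : A k) (b : B) :
    E k (star (x - ι k (E k x)) * ι k b * (y - ι k (E k y))) =
      E k (star x * ι k b * y) - star (E k x) * b * E k y := by
  have h1 := CondExp.apply_mul_incl (E := E) k (star x * ι k b) (E k y)
  have h2 := CondExp.apply_incl_mul (E := E) k y (star (E k x) * b)
  have h3 := CondExp.apply_mul_incl (E := E) k (star x) b
  have h4 := (E k).map_incl (star (E k x) * b * E k y)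
  simp only [map_mul, map_star] at h1 h2 h3 h4
  simp only [star_sub, sub_mul, mul_sub, map_sub, ← map_star (ι k)] at *
  rw [h1, h2, h3, h4]
  abel

theorem Middle.head_ne {k l : Fin 2} (t : Middle E k l) {j : Fin 2} {y : A j} {s : List (Σ k, A k)}
    (h : t.list = ⟨j, y⟩ :: s) : j ≠ k ∧ E j y = 0 := by
  have hc := t.chain
  rw [h] at hc
  simp only [List.map_cons, List.cons_append, List.isChain_cons_cons] at hc
  exact ⟨hc.1.symm, t.centred ⟨j, y⟩ (by simp [h])⟩

/-- A vector `η ⊗ ⋯` whose second letter is centred is orthogonal to centred tensors. -/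
theorem wordForm_unit_left {k l : Fin 2} (b : B) (w : List (Σ k, A k)) {k' : Fin 2} (h : k ≠ k')
    (t : Middle E k l) : wordForm E b (⟨k', 1⟩ :: w) t.list = 0 := by
  rcases ht : t.list with _ | ⟨⟨j, y⟩, s⟩
  · simp [wordForm]
  · obtain ⟨h1, h2⟩ := t.head_ne ht
    obtain rfl : j = k' := Elem.fin_two_eq h h1.symm
    simp [wordForm, CondExp.apply_incl_mul, h2]

theorem wordForm_unit_right {k l : Fin 2} (b : B) (w : List (Σ k, A k)) {k' : Fin 2} (h : k ≠ k')
    (t : Middle E k l) : wordForm E b t.list (⟨k', 1⟩ :: w) = 0 := by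
  rw [← star_star (wordForm E b _ _), star_wordForm, wordForm_unit_left _ _ h, star_zero]

theorem CondExp.map_one' (k : Fin 2) : E k 1 = 1 := by
  simpa using (E k).map_incl 1

theorem form_leftMul_single {k l : Fin 2} (b : B) (v w : Elem E k l) :
    (vertexKernel E k l).form (leftMul (ι k b) v) ((vertexKernel E k l).single w 1) =
      ι l (wordForm E (star b) v.toList w.toList) := by
  rw [← PosKernel.star_form, form_single_leftMul, ← map_star, star_wordForm]

theorem vertexFlip_isometry {k k' l : Fin 2} (h : k ≠ k') (v w : Elem E k l) :
    (vertexKernel E k' l).form (vertexFlip h v) (vertexFlip h w) =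
      (vertexKernel E k l).form ((vertexKernel E k l).single v 1)
        ((vertexKernel E k l).single w 1) := by
  cases v with
  | nil =>
    cases w with
    | nil => simp [wordForm, CondExp.map_one']
    | cons y s =>
      simp [PosKernel.form_add_right, form_single_leftMul, wordForm, wordForm_unit_left _ _ h]
  | cons x t =>
    cases w with
    | nil =>
      simp [PosKernel.form_add_left, form_leftMul_single, wordForm, wordForm_unit_right _ _ h]
    | cons y s =>
      have e := CondExp.apply_centred (E := E) k x y 1
      simp only [map_one, mul_one] at e
      simp [PosKernel.form_add_left, PosKernel.form_add_right, form_single_leftMul,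
        form_leftMul_single, form_leftMul_leftMul, wordForm, wordForm_unit_left _ _ h,
        wordForm_unit_right _ _ h, CondExp.map_one', -star_sub, e]
      rw [← map_add, ← wordForm_add, sub_add_cancel]

/-- Only the centred part of a letter is seen by centred tensors. -/
theorem wordForm_centre_left {k k' l : Fin 2} (h : k ≠ k') (b : B) (x : A k)
    (w : List (Σ k, A k)) (s : Middle E k' l) :
    wordForm E b (⟨k, x - ι k (E k x)⟩ :: w) s.list = wordForm E b (⟨k, x⟩ :: w) s.list := by
  rcases hs : s.list with _ | ⟨⟨j, y⟩, r⟩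
  · simp [wordForm]
  · obtain ⟨h1, h2⟩ := s.head_ne hs
    obtain rfl : j = k := Elem.fin_two_eq h.symm h1.symm
    have e := CondExp.apply_incl_mul (E := E) j y (star (E j x) * b)
    simp only [map_mul, map_star] at e
    simp [wordForm, sub_mul, e, h2]

theorem wordForm_centre_right {k k' l : Fin 2} (h : k ≠ k') (b : B) (x : A k)
    (w : List (Σ k, A k)) (s : Middle E k' l) :
    wordForm E b s.list (⟨k, x - ι k (E k x)⟩ :: w) = wordForm E b s.list (⟨k, x⟩ :: w) := by
  rw [← star_star (wordForm E b _ _), star_wordForm, wordForm_centre_left h, star_wordForm,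
    star_star]

theorem vertexFlip_adjoint {k k' l : Fin 2} (h : k ≠ k') (v : Elem E k l) (w : Elem E k' l) :
    (vertexKernel E k' l).form (vertexFlip h v) ((vertexKernel E k' l).single w 1) =
      (vertexKernel E k l).form ((vertexKernel E k l).single v 1) (vertexFlip h.symm w) := by
  cases v with
  | nil =>
    cases w with
    | nil => exact absurd rfl h
    | cons y s =>
      simp [PosKernel.form_add_right, form_single_leftMul, wordForm]
  | cons x t =>
    cases w with
    | nil =>
      simp [PosKernel.form_add_left, form_leftMul_single, wordForm, CondExp.apply_star]
    | cons y s =>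
      simp [PosKernel.form_add_left, PosKernel.form_add_right, form_single_leftMul,
        form_leftMul_single, wordForm, CondExp.apply_star, wordForm_centre_left h,
        wordForm_centre_right h.symm, -star_sub]
      abel

theorem form_lift_vertexFlip {k k' l : Fin 2} (h : k ≠ k') (f g : (vertexKernel E k l).Pre) :
    (vertexKernel E k' l).form (PosKernel.lift (vertexFlip h) f) (PosKernel.lift (vertexFlip h) g) =
      (vertexKernel E k l).form f g := by
  have e := PosKernel.form_lift (K := vertexKernel E k l) (L := vertexKernel E k' l)
    (M := vertexKernel E k l) (N := vertexKernel E k l) (vertexFlip_isometry h) f g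
  rwa [PosKernel.lift_self, PosKernel.lift_self] at e

theorem norm_lift_vertexFlip {k k' l : Fin 2} (h : k ≠ k') (f : (vertexKernel E k l).Pre) :
    ‖PosKernel.lift (L := vertexKernel E k' l) (vertexFlip h) f‖ ≤ 1 * ‖f‖ := by
  have e := PosKernel.norm_sq _ (PosKernel.lift (L := vertexKernel E k' l) (vertexFlip h) f)
  rw [form_lift_vertexFlip, ← PosKernel.norm_sq] at e
  rw [one_mul]
  exact (abs_le_of_sq_le_sq' e.le (Real.sqrt_nonneg _)).2

variable (E) in
/-- `u_{k,l}` as a map between the completions. -/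
noncomputable def vertexFlipL {k k' : Fin 2} (h : k ≠ k') (l : Fin 2) :
    VertexModule E k l →L[ℂ] VertexModule E k' l :=
  PosKernel.extend (PosKernel.lift (vertexFlip h))

theorem vertexFlipL_toHilb {k k' l : Fin 2} (h : k ≠ k') (f : (vertexKernel E k l).Pre) :
    vertexFlipL E h l (PosKernel.toHilb _ f) =
      PosKernel.toHilb _ (PosKernel.lift (L := vertexKernel E k' l) (vertexFlip h) f) :=
  PosKernel.extend_toHilb (norm_lift_vertexFlip h) f

theorem vertexFlipL_vertexFlipL {k k' l : Fin 2} (h : k ≠ k') (h' : k' ≠ k)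
    (x : VertexModule E k l) :
    vertexFlipL E h' l (vertexFlipL E h l x) = x := by
  induction x using PosKernel.hilb_induction with
  | hc => exact isClosed_eq (by fun_prop) continuous_id
  | h f =>
    rw [vertexFlipL_toHilb, vertexFlipL_toHilb]
    refine PosKernel.toHilb_eq_of_form fun g => ?_
    rw [← PosKernel.form_lift_self (vertexFlip_adjoint h), form_lift_vertexFlip]

theorem inner_vertexFlipL {k k' l : Fin 2} (h : k ≠ k') (x y : VertexModule E k l) :
    inner (A l)ᵐᵒᵖ (vertexFlipL E h l x) (vertexFlipL E h l y) = inner (A l)ᵐᵒᵖ x y := by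
  refine congrArg op ?_
  induction x using PosKernel.hilb_induction with
  | hc => exact isClosed_eq
            (PosKernel.continuous_innerSL _ (vertexFlipL E h l).continuous continuous_const)
            (PosKernel.continuous_innerSL _ continuous_id continuous_const)
  | h f =>
    induction y using PosKernel.hilb_induction with
    | hc => exact isClosed_eq
              (PosKernel.continuous_innerSL _ continuous_const (vertexFlipL E h l).continuous)
              (PosKernel.continuous_innerSL _ continuous_const continuous_id)
    | h g => rw [vertexFlipL_toHilb, vertexFlipL_toHilb, PosKernel.innerSL_toHilb,
        PosKernel.innerSL_toHilb, form_lift_vertexFlip]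

variable (E) in
/-- The unitary `u_{k,l} : H_{k,l} → H_{k',l}`, for `{k, k'} = {1, 2}`. -/
noncomputable def vertexUnitary {k k' : Fin 2} (h : k ≠ k') (l : Fin 2) :
    HilbertUnitary (A l)ᵐᵒᵖ (VertexModule E k l) (VertexModule E k' l) where
  equiv := ContinuousLinearEquiv.equivOfInverse (vertexFlipL E h l) (vertexFlipL E h.symm l)
    (vertexFlipL_vertexFlipL h h.symm) (vertexFlipL_vertexFlipL h.symm h)
  inner_map := inner_vertexFlipL h

variable (E) in
/-- The restriction to `A j` of the representation `π_k` on `H_{k,k}`: it is `λ_{k,k}` for `j = k`,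
and `a ↦ u⋆ λ_{j,k}(a) u` with `u = u_{k,k} : H_{k,k} → H_{j,k}` otherwise. -/
noncomputable def vertexRep (k j : Fin 2) :
    A j →⋆ₐ[ℂ] Adjointable (A k)ᵐᵒᵖ (VertexModule E k k) :=
  if h : k = j then h ▸ leftRep E k k
  else (vertexUnitary E h k).conj.comp (leftRep E j k)

theorem form_vertexFlip_leftMul {k k' l : Fin 2} (h : k ≠ k') (b : B) (w : Elem E k' l)
    (v : Elem E k l) :
    (vertexKernel E k l).form (vertexFlip h.symm w) (leftMul (ι k b) v) =
      (vertexKernel E k' l).form (leftMul (ι k' (star b)) w) (vertexFlip h v) := by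
  cases v with
  | nil =>
    cases w with
    | nil => exact absurd rfl h
    | cons y s =>
      have e := CondExp.apply_mul_incl (E := E) k' (star y) b
      simp [PosKernel.form_add_left, form_leftMul_leftMul, form_single_leftMul, form_leftMul_single,
        wordForm, e, CondExp.apply_star, -leftMul_cons, -leftMul_nil]
  | cons x t =>
    cases w with
    | nil =>
      simp [PosKernel.form_add_right, form_leftMul_leftMul, form_single_leftMul,
        form_leftMul_single, wordForm, CondExp.apply_incl_mul, -leftMul_cons, -leftMul_nil]
    | cons y s =>
      have e := CondExp.apply_mul_incl (E := E) k' (star y) b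
      simp [PosKernel.form_add_left, PosKernel.form_add_right, form_leftMul_leftMul,
        form_single_leftMul, form_leftMul_single, wordForm, CondExp.apply_star, e,
        CondExp.apply_incl_mul,
        wordForm_centre_left h.symm, wordForm_centre_right h, -star_sub, -leftMul_cons,
        -leftMul_nil]
      abel

theorem vertexFlip_intertwines {k k' l : Fin 2} (h : k ≠ k') (b : B) (v : Elem E k l) :
    PosKernel.toHilb _
      (PosKernel.lift (L := vertexKernel E k' l) (vertexFlip h) (leftMul (ι k b) v)) =
    PosKernel.toHilb _
      (PosKernel.lift (L := vertexKernel E k' l) (leftMul (ι k' b)) (vertexFlip h v)) := by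
  refine PosKernel.toHilb_eq_of_form fun g => ?_
  rw [← PosKernel.form_lift_self (vertexFlip_adjoint h.symm)]
  have e := (leftAction E k' l).form_left (star (ι k' b)) g (vertexFlip h v)
  rw [star_star] at e
  refine Eq.trans ?_ e
  clear e
  induction g using PosKernel.pre_induction with
  | h0 => simp
  | ha f g hf hg => simp only [map_add, PosKernel.form_add_left, hf, hg]
  | hs w a =>
    rw [PosKernel.lift_single, PosKernel.lift_single, PosKernel.form_smul_left,
      PosKernel.form_smul_left, form_vertexFlip_leftMul h, map_star]
    rfl

/-- `π_k` is well defined: the representations of `A 0` and `A 1` on `H_{k,k}` agree on `B`. -/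
theorem vertexRep_incl (k j : Fin 2) (b : B) :
    vertexRep E k j (ι j b) = leftRep E k k (ι k b) := by
  unfold vertexRep
  split_ifs with h
  · subst h; rfl
  · refine Subtype.ext (PosKernel.Action.op_ext fun f => ?_)
    change (vertexUnitary E h k).equiv.symm ((leftAction E j k).op (ι j b)
      (vertexFlipL E h k (PosKernel.toHilb _ f))) =
        (leftAction E k k).op (ι k b) (PosKernel.toHilb _ f)
    rw [ContinuousLinearEquiv.symm_apply_eq]
    change _ = vertexFlipL E h k _
    rw [vertexFlipL_toHilb, PosKernel.Action.op_toHilb, PosKernel.Action.op_toHilb,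
      vertexFlipL_toHilb]
    induction f using PosKernel.pre_induction with
    | h0 => simp
    | ha f g hf hg => simp only [map_add, hf, hg]
    | hs v a =>
      have e := congrArg (op a • ·) (vertexFlip_intertwines h b v).symm
      simp only [← PosKernel.toHilb_smul, ← PosKernel.lift_smul] at e
      simp only [PosKernel.lift_single]
      exact e

end VertexModules

section CStarCompletion

/-- A C⋆-seminorm on a unital complex `⋆`-algebra. -/
structure CStarSeminorm (R : Type*) [Ring R] [Algebra ℂ R] [StarRing R] where
  toFun : R → ℝ
  add_le : ∀ x y, toFun (x + y) ≤ toFun x + toFun y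
  smul_eq : ∀ (c : ℂ) x, toFun (c • x) = ‖c‖ * toFun x
  mul_le : ∀ x y, toFun (x * y) ≤ toFun x * toFun y
  star_mul_self : ∀ x, toFun (star x * x) = toFun x ^ 2

namespace CStarSeminorm

variable {R : Type*} [Ring R] [Algebra ℂ R] [StarRing R] [StarModule ℂ R] (q : CStarSeminorm R)

theorem zero_eq : q.toFun 0 = 0 := by simpa using q.smul_eq 0 0

theorem neg_eq (x : R) : q.toFun (-x) = q.toFun x := by simpa using q.smul_eq (-1) x

theorem nonneg (x : R) : 0 ≤ q.toFun x := by
  have := q.add_le x (-x)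
  rw [add_neg_cancel, zero_eq, neg_eq] at this
  linarith

theorem le_star (x : R) : q.toFun x ≤ q.toFun (star x) := by
  have h := q.mul_le (star x) x
  rw [q.star_mul_self, pow_two] at h
  by_contra! hlt
  exact absurd h (not_le.mpr (mul_lt_mul_of_pos_right hlt ((q.nonneg _).trans_lt hlt)))

theorem star_norm_eq (x : R) : q.toFun (star x) = q.toFun x :=
  le_antisymm (by simpa using q.le_star (star x)) (q.le_star x)

/-- The algebra `R`, equipped with the seminorm `q`. -/
def Pre (_q : CStarSeminorm R) : Type _ := R

instance : Ring q.Pre := inferInstanceAs (Ring R)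
instance : Algebra ℂ q.Pre := inferInstanceAs (Algebra ℂ R)
instance : StarRing q.Pre := inferInstanceAs (StarRing R)
instance : StarModule ℂ q.Pre := inferInstanceAs (StarModule ℂ R)
instance : Norm q.Pre := ⟨q.toFun⟩

noncomputable instance : SeminormedAddCommGroup q.Pre :=
  SeminormedAddCommGroup.ofCore (𝕜 := ℂ)
    { norm_nonneg := q.nonneg
      norm_smul := q.smul_eq
      norm_triangle := q.add_le }

noncomputable instance : SeminormedRing q.Pre where
  norm_mul_le := q.mul_le
  dist_eq := dist_eq_norm_neg_add

noncomputable instance : NormedSpace ℂ q.Pre where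
  norm_smul_le c x := (q.smul_eq c x).le

theorem norm_pre (x : q.Pre) : ‖x‖ = q.toFun x := rfl

/-- Separation and completion of a `⋆`-algebra with respect to a C⋆-seminorm. -/
def Completion (q : CStarSeminorm R) : Type _ := UniformSpace.Completion q.Pre

noncomputable instance : NormedRing q.Completion :=
  inferInstanceAs (NormedRing (UniformSpace.Completion q.Pre))
noncomputable instance : Algebra ℂ q.Completion :=
  inferInstanceAs (Algebra ℂ (UniformSpace.Completion q.Pre))
instance : CompleteSpace q.Completion :=
  inferInstanceAs (CompleteSpace (UniformSpace.Completion q.Pre))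

noncomputable instance : NormedAlgebra ℂ q.Completion where
  norm_smul_le := norm_smul_le (β := UniformSpace.Completion q.Pre)

/-- The canonical map from a `⋆`-algebra to its completion. -/
noncomputable def coeC (x : R) : q.Completion :=
  UniformSpace.Completion.coe' (α := q.Pre) x

theorem denseRange_coeC : DenseRange q.coeC := UniformSpace.Completion.denseRange_coe (α := q.Pre)

theorem norm_coeC (x : R) : ‖q.coeC x‖ = q.toFun x := UniformSpace.Completion.norm_coe (E := q.Pre) x

theorem coeC_add (x y : R) : q.coeC (x + y) = q.coeC x + q.coeC y :=
  UniformSpace.Completion.coe_add (α := q.Pre) x y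

theorem coeC_mul (x y : R) : q.coeC (x * y) = q.coeC x * q.coeC y :=
  UniformSpace.Completion.coe_mul (α := q.Pre) x y

theorem coeC_one : q.coeC 1 = 1 := UniformSpace.Completion.coe_one q.Pre

theorem coeC_smul (c : ℂ) (x : R) : q.coeC (c • x) = c • q.coeC x :=
  UniformSpace.Completion.coe_smul (X := q.Pre) c x

theorem coeC_zero : q.coeC 0 = 0 := by simpa using q.coeC_smul 0 0

theorem coeC_eq {x y : R} (h : q.toFun (x - y) = 0) : q.coeC x = q.coeC y := by
  have e := q.coeC_add (x - y) y
  have e' : q.coeC (x - y) = 0 := norm_eq_zero.mp (by rw [norm_coeC, h])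
  rwa [sub_add_cancel, e', zero_add] at e

@[elab_as_elim]
theorem completion_induction {p : q.Completion → Prop} (hc : IsClosed {x | p x})
    (h : ∀ x, p (q.coeC x)) (x : q.Completion) : p x :=
  q.denseRange_coeC.induction_on x hc h

noncomputable instance : Star q.Completion :=
  ⟨UniformSpace.Completion.map (star : q.Pre → q.Pre)⟩

theorem uniformContinuous_star : UniformContinuous (star : q.Pre → q.Pre) :=
  Isometry.uniformContinuous <| AddMonoidHomClass.isometry_of_norm (starAddEquiv : q.Pre ≃+ q.Pre)
    q.star_norm_eq

theorem star_coeC (x : R) : star (q.coeC x) = q.coeC (star x) :=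
  UniformSpace.Completion.map_coe q.uniformContinuous_star x

theorem continuous_star : Continuous (star : q.Completion → q.Completion) :=
  UniformSpace.Completion.continuous_map (α := q.Pre) (β := q.Pre)

noncomputable instance : StarRing q.Completion where
  star_involutive x := by
    induction x using q.completion_induction with
    | hc => exact isClosed_eq (q.continuous_star.comp q.continuous_star) continuous_id
    | h x => rw [star_coeC, star_coeC, star_star]
  star_mul x y := by
    induction x using q.completion_induction with
    | hc => exact isClosed_eq (q.continuous_star.comp (continuous_id.mul continuous_const))
              (continuous_const.mul q.continuous_star)
    | h x =>
      induction y using q.completion_induction with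
      | hc => exact isClosed_eq (q.continuous_star.comp (continuous_const.mul continuous_id))
                (q.continuous_star.mul continuous_const)
      | h y => rw [← coeC_mul, star_coeC, star_coeC, star_coeC, star_mul, coeC_mul]
  star_add x y := by
    induction x using q.completion_induction with
    | hc => exact isClosed_eq (q.continuous_star.comp (continuous_id.add continuous_const))
              (q.continuous_star.add continuous_const)
    | h x =>
      induction y using q.completion_induction with
      | hc => exact isClosed_eq (q.continuous_star.comp (continuous_const.add continuous_id))
                (continuous_const.add q.continuous_star)
      | h y => rw [← coeC_add, star_coeC, star_coeC, star_coeC, star_add, coeC_add]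

instance : StarModule ℂ q.Completion where
  star_smul c x := by
    induction x using q.completion_induction with
    | hc => exact isClosed_eq (q.continuous_star.comp (continuous_const_smul c))
              (q.continuous_star.const_smul (star c))
    | h x => rw [← coeC_smul, star_coeC, star_coeC, star_smul, coeC_smul]

instance : CStarRing q.Completion where
  norm_mul_self_le x := by
    refine le_of_eq ?_
    induction x using q.completion_induction with
    | hc => exact isClosed_eq (by fun_prop) ((q.continuous_star.mul continuous_id).norm)
    | h x => rw [star_coeC, ← coeC_mul, norm_coeC, norm_coeC, star_mul_self, pow_two]

noncomputable instance : CStarAlgebra q.Completion where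

/-- The canonical `⋆`-homomorphism from a `⋆`-algebra to its completion. -/
noncomputable def toCompletion : R →⋆ₐ[ℂ] q.Completion where
  toFun := q.coeC
  map_one' := q.coeC_one
  map_mul' := q.coeC_mul
  map_zero' := q.coeC_zero
  map_add' := q.coeC_add
  commutes' c := by
    rw [Algebra.algebraMap_eq_smul_one, Algebra.algebraMap_eq_smul_one, coeC_smul, coeC_one]
  map_star' x := (q.star_coeC x).symm

variable {q} {D : Type*} [CStarAlgebra D]

/-- A `⋆`-homomorphism bounded by `q`, as a continuous linear map. -/
noncomputable def liftL (φ : R →⋆ₐ[ℂ] D) (h : ∀ x, ‖φ x‖ ≤ q.toFun x) : q.Pre →L[ℂ] D :=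
  LinearMap.mkContinuous (E := q.Pre)
    { toFun := fun x : R => φ x
      map_add' := fun x y : R => map_add φ x y
      map_smul' := fun c (x : R) => map_smul φ c x } 1
    fun x => (h x).trans (one_mul _).ge

/-- The extension by continuity of a `⋆`-homomorphism into a C⋆-algebra to the completion. -/
noncomputable def lift (φ : R →⋆ₐ[ℂ] D) (h : ∀ x, ‖φ x‖ ≤ q.toFun x) : q.Completion →⋆ₐ[ℂ] D :=
  let ψ : q.Completion → D := UniformSpace.Completion.extension (liftL φ h)
  have hψ : Continuous ψ := UniformSpace.Completion.continuous_extension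
  have e (x : R) : ψ (q.coeC x) = φ x :=
    UniformSpace.Completion.extension_coe (liftL φ h).uniformContinuous x
  { toFun := ψ
    map_one' := by rw [← coeC_one, e, map_one]
    map_zero' := by rw [← coeC_zero, e, map_zero]
    map_mul' := fun x y => by
      induction x using q.completion_induction with
      | hc => exact isClosed_eq (by fun_prop) (by fun_prop)
      | h x =>
        induction y using q.completion_induction with
        | hc => exact isClosed_eq (by fun_prop) (by fun_prop)
        | h y => rw [← coeC_mul, e, e, e, map_mul]
    map_add' := fun x y => by
      induction x using q.completion_induction with
      | hc => exact isClosed_eq (by fun_prop) (by fun_prop)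
      | h x =>
        induction y using q.completion_induction with
        | hc => exact isClosed_eq (by fun_prop) (by fun_prop)
        | h y => rw [← coeC_add, e, e, e, map_add]
    commutes' := fun c => by
      rw [Algebra.algebraMap_eq_smul_one, ← coeC_one, ← coeC_smul, e, map_smul, map_one,
        Algebra.algebraMap_eq_smul_one]
    map_star' := fun x => by
      induction x using q.completion_induction with
      | hc => exact isClosed_eq (hψ.comp q.continuous_star) hψ.star
      | h x => rw [star_coeC, e, e, map_star] }

@[simp] theorem lift_toCompletion (φ : R →⋆ₐ[ℂ] D) (h : ∀ x, ‖φ x‖ ≤ q.toFun x) (x : R) :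
    lift φ h (q.toCompletion x) = φ x :=
  UniformSpace.Completion.extension_coe (liftL φ h).uniformContinuous x

end CStarSeminorm

end CStarCompletion

section FullProduct

/-- The free unital complex algebra on the disjoint union of the sets `A 0` and `A 1`. -/
def FreeStar (A : Fin 2 → Type u) : Type u := FreeAlgebra ℂ (Σ k, A k)

noncomputable instance (A : Fin 2 → Type u) : Ring (FreeStar A) :=
  inferInstanceAs (Ring (FreeAlgebra ℂ (Σ k, A k)))
noncomputable instance (A : Fin 2 → Type u) : Algebra ℂ (FreeStar A) :=
  inferInstanceAs (Algebra ℂ (FreeAlgebra ℂ (Σ k, A k)))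

namespace FreeStar

variable {A : Fin 2 → Type u}

/-- The free generator given by `a ∈ A k`. -/
noncomputable def letter (k : Fin 2) (a : A k) : FreeStar A := FreeAlgebra.ι ℂ ⟨k, a⟩

@[elab_as_elim]
theorem induction {p : FreeStar A → Prop} (hc : ∀ c : ℂ, p (algebraMap ℂ _ c))
    (hl : ∀ k a, p (letter k a)) (hm : ∀ x y, p x → p y → p (x * y))
    (ha : ∀ x y, p x → p y → p (x + y)) (x : FreeStar A) : p x :=
  FreeAlgebra.induction ℂ (Σ k, A k) (motive := p) hc (fun x => hl x.1 x.2) hm ha x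

/-- The conjugate complex algebra structure. -/
@[reducible] noncomputable def conjAlgebra (R : Type*) [Ring R] [Algebra ℂ R] : Algebra ℂ R :=
  ((algebraMap ℂ R).comp (starRingEnd ℂ)).toAlgebra' fun _ x => Algebra.commutes _ x

variable [∀ k, CStarAlgebra (A k)]

/-- The conjugate-linear antihomomorphism which extends `a ↦ a⋆` on the generators. -/
noncomputable def starHom : FreeStar A →+* (FreeStar A)ᵐᵒᵖ :=
  letI := conjAlgebra (FreeStar A)ᵐᵒᵖ
  (FreeAlgebra.lift ℂ fun x : Σ k, A k => op (letter x.1 (star x.2)) :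
    FreeAlgebra ℂ (Σ k, A k) →ₐ[ℂ] (FreeStar A)ᵐᵒᵖ).toRingHom

theorem starHom_letter (k : Fin 2) (a : A k) : starHom (letter k a) = op (letter k (star a)) :=
  letI := conjAlgebra (FreeStar A)ᵐᵒᵖ
  FreeAlgebra.lift_ι_apply (A := (FreeStar A)ᵐᵒᵖ) (fun x : Σ k, A k => op (letter x.1 (star x.2)))
    ⟨k, a⟩

theorem starHom_algebraMap (c : ℂ) :
    starHom (algebraMap ℂ (FreeStar A) c) = op (algebraMap ℂ (FreeStar A) (star c)) :=
  letI := conjAlgebra (FreeStar A)ᵐᵒᵖ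
  (FreeAlgebra.lift ℂ fun x : Σ k, A k => op (letter x.1 (star x.2)) :
    FreeAlgebra ℂ (Σ k, A k) →ₐ[ℂ] (FreeStar A)ᵐᵒᵖ).commutes c

noncomputable instance : Star (FreeStar A) := ⟨fun x => unop (starHom x)⟩

@[simp] theorem star_letter (k : Fin 2) (a : A k) : star (letter k a) = letter k (star a) :=
  congrArg unop (starHom_letter k a)

theorem star_algebraMap (c : ℂ) :
    star (algebraMap ℂ (FreeStar A) c) = algebraMap ℂ (FreeStar A) (star c) :=
  congrArg unop (starHom_algebraMap c)

noncomputable instance : StarRing (FreeStar A) where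
  star_mul x y := congrArg unop (map_mul starHom x y)
  star_add x y := congrArg unop (map_add starHom x y)
  star_involutive x := by
    have hm (x y : FreeStar A) : star (x * y) = star y * star x :=
      congrArg unop (map_mul starHom x y)
    have ha (x y : FreeStar A) : star (x + y) = star x + star y :=
      congrArg unop (map_add starHom x y)
    induction x using FreeStar.induction with
    | hc c => rw [star_algebraMap, star_algebraMap, star_star]
    | hl k a => rw [star_letter, star_letter, star_star]
    | hm x y hx hy => rw [hm, hm, hx, hy]
    | ha x y hx hy => rw [ha, ha, hx, hy]

instance : StarModule ℂ (FreeStar A) where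
  star_smul c x := by
    rw [Algebra.smul_def, star_mul, star_algebraMap, Algebra.smul_def, Algebra.commutes]

/-- The `⋆`-homomorphism into a C⋆-algebra with prescribed (`⋆`-preserving) values on the
generators. -/
noncomputable def eval {D : Type*} [CStarAlgebra D] (φ : ∀ k, A k →⋆ₐ[ℂ] D) :
    FreeStar A →⋆ₐ[ℂ] D :=
  let ψ : FreeStar A →ₐ[ℂ] D := FreeAlgebra.lift ℂ fun x : Σ k, A k => φ x.1 x.2
  { ψ with
    map_star' := fun x => by
      change ψ (star x) = star (ψ x)
      have e (k : Fin 2) (a : A k) : ψ (letter k a) = φ k a :=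
        FreeAlgebra.lift_ι_apply (fun x : Σ k, A k => φ x.1 x.2) ⟨k, a⟩
      induction x using FreeStar.induction with
      | hc c => simp only [star_algebraMap, AlgHom.commutes]; exact algebraMap_star_comm c
      | hl k a => rw [star_letter, e, e, map_star]
      | hm x y hx hy => rw [star_mul, map_mul, map_mul, star_mul, hx, hy]
      | ha x y hx hy => rw [star_add, map_add, map_add, star_add, hx, hy] }

@[simp] theorem eval_letter {D : Type*} [CStarAlgebra D] (φ : ∀ k, A k →⋆ₐ[ℂ] D) (k : Fin 2)
    (a : A k) : eval φ (letter k a) = φ k a :=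
  FreeAlgebra.lift_ι_apply (fun x : Σ k, A k => φ x.1 x.2) ⟨k, a⟩

end FreeStar

variable {A : Fin 2 → Type u} [∀ k, CStarAlgebra (A k)] {B : Type v} [CStarAlgebra B]
  (ι : ∀ k, B →⋆ₐ[ℂ] A k)

/-- The values of `‖φ x‖`, where `φ` runs through the pairs of unital `⋆`-homomorphisms of `A 0` and
`A 1` into a C⋆-algebra which agree on `B`. -/
def fullNorms (x : FreeStar A) : Set ℝ :=
  {r | ∃ (D : Type u) (_ : CStarAlgebra D) (φ : ∀ k, A k →⋆ₐ[ℂ] D),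
    (∀ b, φ 0 (ι 0 b) = φ 1 (ι 1 b)) ∧ r = ‖FreeStar.eval φ x‖}

theorem fullNorms_bddAbove (x : FreeStar A) : BddAbove (fullNorms ι x) := by
  suffices h : ∃ C : ℝ, ∀ (D : Type u) (_ : CStarAlgebra D) (φ : ∀ k, A k →⋆ₐ[ℂ] D),
      ‖FreeStar.eval φ x‖ ≤ C by
    obtain ⟨C, hC⟩ := h
    exact ⟨C, by rintro r ⟨D, _, φ, -, rfl⟩; exact hC D _ φ⟩
  induction x using FreeStar.induction with
  | hc c =>
    refine ⟨‖algebraMap ℂ (A 0) c‖, fun D _ φ => ?_⟩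
    rw [AlgHomClass.commutes, ← AlgHomClass.commutes (φ 0)]
    exact NonUnitalStarAlgHom.norm_apply_le (φ 0) _
  | hl k a =>
    refine ⟨‖a‖, fun D _ φ => ?_⟩
    rw [FreeStar.eval_letter]
    exact NonUnitalStarAlgHom.norm_apply_le (φ k) _
  | hm x y hx hy =>
    obtain ⟨C, hC⟩ := hx
    obtain ⟨C', hC'⟩ := hy
    refine ⟨C * C', fun D _ φ => ?_⟩
    rw [map_mul]
    exact (norm_mul_le _ _).trans (mul_le_mul (hC D _ φ) (hC' D _ φ) (norm_nonneg _)
      ((norm_nonneg _).trans (hC D _ φ)))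
  | ha x y hx hy =>
    obtain ⟨C, hC⟩ := hx
    obtain ⟨C', hC'⟩ := hy
    refine ⟨C + C', fun D _ φ => ?_⟩
    rw [map_add]
    exact (norm_add_le _ _).trans (add_le_add (hC D _ φ) (hC' D _ φ))

theorem fullNorms_nonempty (x : FreeStar A) : (fullNorms ι x).Nonempty :=
  ⟨_, PEmpty.{u + 1} → ℂ, inferInstance, fun _ =>
    { toFun := 0
      map_one' := Subsingleton.elim _ _
      map_zero' := rfl
      map_mul' := fun _ _ => Subsingleton.elim _ _
      map_add' := fun _ _ => Subsingleton.elim _ _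
      commutes' := fun _ => Subsingleton.elim _ _
      map_star' := fun _ => Subsingleton.elim _ _ }, fun _ => rfl, rfl⟩

theorem fullNorms_nonneg {x : FreeStar A} {r : ℝ} (h : r ∈ fullNorms ι x) : 0 ≤ r := by
  obtain ⟨D, _, φ, -, rfl⟩ := h
  exact norm_nonneg _

theorem norm_eval_le {D : Type u} [CStarAlgebra D] (φ : ∀ k, A k →⋆ₐ[ℂ] D)
    (h : ∀ b, φ 0 (ι 0 b) = φ 1 (ι 1 b)) (x : FreeStar A) :
    ‖FreeStar.eval φ x‖ ≤ sSup (fullNorms ι x) :=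
  le_csSup (fullNorms_bddAbove ι x) ⟨D, _, φ, h, rfl⟩

open scoped Pointwise in
/-- The universal C⋆-seminorm `‖x‖_f = sup ‖φ x‖`. -/
noncomputable def fullSeminorm : CStarSeminorm (FreeStar A) where
  toFun x := sSup (fullNorms ι x)
  add_le x y := csSup_le (fullNorms_nonempty ι _) <| by
    rintro r ⟨D, _, φ, h, rfl⟩
    rw [map_add]
    exact (norm_add_le _ _).trans (add_le_add (norm_eval_le ι φ h x) (norm_eval_le ι φ h y))
  smul_eq c x := by
    have e : fullNorms ι (c • x) = ‖c‖ • fullNorms ι x := by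
      ext r
      constructor
      · rintro ⟨D, _, φ, h, rfl⟩
        exact ⟨_, ⟨D, _, φ, h, rfl⟩, by simp only [map_smul, norm_smul, smul_eq_mul]⟩
      · rintro ⟨_, ⟨D, _, φ, h, rfl⟩, rfl⟩
        exact ⟨D, _, φ, h, by simp only [map_smul, norm_smul, smul_eq_mul]⟩
    rw [e, Real.sSup_smul_of_nonneg (norm_nonneg c), smul_eq_mul]
  mul_le x y := csSup_le (fullNorms_nonempty ι _) <| by
    rintro r ⟨D, _, φ, h, rfl⟩
    rw [map_mul]
    exact (norm_mul_le _ _).trans (mul_le_mul (norm_eval_le ι φ h x) (norm_eval_le ι φ h y)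
      (norm_nonneg _) ((norm_nonneg _).trans (norm_eval_le ι φ h x)))
  star_mul_self x := by
    refine le_antisymm (csSup_le (fullNorms_nonempty ι _) ?_) ?_
    · rintro r ⟨D, _, φ, h, rfl⟩
      rw [map_mul, map_star, CStarRing.norm_star_mul_self, ← pow_two]
      exact pow_le_pow_left₀ (norm_nonneg _) (norm_eval_le ι φ h x) 2
    · have h0 : 0 ≤ sSup (fullNorms ι (star x * x)) :=
        Real.sSup_nonneg fun r hr => fullNorms_nonneg ι hr
      rw [← Real.le_sqrt (Real.sSup_nonneg fun r hr => fullNorms_nonneg ι hr) h0]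
      refine csSup_le (fullNorms_nonempty ι _) ?_
      rintro r ⟨D, _, φ, h, rfl⟩
      refine Real.le_sqrt_of_sq_le ?_
      have := norm_eval_le ι φ h (star x * x)
      rwa [map_mul, map_star, CStarRing.norm_star_mul_self, ← pow_two] at this

/-- The full amalgamated free product `A_f = A 0 *_B A 1`: the completion of the free `⋆`-algebra on
`A 0` and `A 1` in the largest C⋆-seminorm that comes from pairs of unital `⋆`-homomorphisms of
`A 0` and `A 1` which agree on `B`. -/
abbrev FullProduct : Type u := (fullSeminorm ι).Completion

theorem toCompletion_eq {x y : FreeStar A}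
    (h : ∀ (D : Type u) [CStarAlgebra D] (φ : ∀ k, A k →⋆ₐ[ℂ] D),
      (∀ b, φ 0 (ι 0 b) = φ 1 (ι 1 b)) → FreeStar.eval φ x = FreeStar.eval φ y) :
    (fullSeminorm ι).toCompletion x = (fullSeminorm ι).toCompletion y := by
  refine CStarSeminorm.coeC_eq _ (le_antisymm ?_ (CStarSeminorm.nonneg _ _))
  refine csSup_le (fullNorms_nonempty ι _) ?_
  rintro r ⟨D, _, φ, hφ, rfl⟩
  rw [map_sub, h D φ hφ, sub_self, norm_zero]

/-- The canonical unital `⋆`-homomorphism `A k → A_f`. -/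
noncomputable def inFull (k : Fin 2) : A k →⋆ₐ[ℂ] FullProduct ι where
  toFun a := (fullSeminorm ι).toCompletion (FreeStar.letter k a)
  map_one' := by
    rw [← map_one (fullSeminorm ι).toCompletion]
    exact toCompletion_eq ι fun D _ φ _ => by simp
  map_mul' a b := by
    rw [← map_mul]
    exact toCompletion_eq ι fun D _ φ _ => by simp
  map_zero' := by
    rw [← map_zero (fullSeminorm ι).toCompletion]
    exact toCompletion_eq ι fun D _ φ _ => by simp
  map_add' a b := by
    rw [← map_add]
    exact toCompletion_eq ι fun D _ φ _ => by simp
  commutes' c := by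
    rw [← AlgHomClass.commutes (fullSeminorm ι).toCompletion]
    exact toCompletion_eq ι fun D _ φ _ => by
      rw [FreeStar.eval_letter, AlgHomClass.commutes, AlgHomClass.commutes]
  map_star' a := by
    rw [← map_star]
    exact toCompletion_eq ι fun D _ φ _ => by simp

theorem inFull_incl (b : B) : inFull ι 0 (ι 0 b) = inFull ι 1 (ι 1 b) :=
  toCompletion_eq ι fun D _ φ h => by simpa using h b

variable {ι}

theorem norm_eval_le_full {D : Type u} [CStarAlgebra D] (φ : ∀ k, A k →⋆ₐ[ℂ] D)
    (h : ∀ b, φ 0 (ι 0 b) = φ 1 (ι 1 b)) (x : FreeStar A) :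
    ‖FreeStar.eval φ x‖ ≤ (fullSeminorm ι).toFun x := norm_eval_le ι φ h x

/-- The universal property of `A_f`. -/
noncomputable def fullLift {D : Type u} [CStarAlgebra D] (φ : ∀ k, A k →⋆ₐ[ℂ] D)
    (h : ∀ b, φ 0 (ι 0 b) = φ 1 (ι 1 b)) : FullProduct ι →⋆ₐ[ℂ] D :=
  CStarSeminorm.lift (FreeStar.eval φ) (norm_eval_le_full φ h)

@[simp] theorem fullLift_inFull {D : Type u} [CStarAlgebra D] (φ : ∀ k, A k →⋆ₐ[ℂ] D)
    (h : ∀ b, φ 0 (ι 0 b) = φ 1 (ι 1 b)) (k : Fin 2) (a : A k) :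
    fullLift φ h (inFull ι k a) = φ k a := by
  change fullLift φ h ((fullSeminorm ι).toCompletion (FreeStar.letter k a)) = _
  unfold fullLift
  rw [CStarSeminorm.lift_toCompletion, FreeStar.eval_letter]

end FullProduct

section VertexProduct

variable {A : Fin 2 → Type u} [∀ k, CStarAlgebra (A k)] [∀ k, PartialOrder (A k)]
  [∀ k, StarOrderedRing (A k)] {B : Type v} [CStarAlgebra B] [PartialOrder B] [StarOrderedRing B]
  {ι : ∀ k, B →⋆ₐ[ℂ] A k} (E : ∀ k, CondExp (ι k))

/-- The representation `π_k : A_f → 𝓛(H_{k,k})`. -/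
noncomputable def vertexPi (k : Fin 2) :
    FullProduct ι →⋆ₐ[ℂ] Adjointable (A k)ᵐᵒᵖ (VertexModule E k k) :=
  fullLift (vertexRep E k) fun b => (vertexRep_incl k 0 b).trans (vertexRep_incl k 1 b).symm

/-- The C⋆-seminorm `‖x‖_v = max (‖π_0 x‖) (‖π_1 x‖)` on `A_f`. -/
noncomputable def vertexSeminorm : CStarSeminorm (FullProduct ι) where
  toFun x := max ‖vertexPi E 0 x‖ ‖vertexPi E 1 x‖
  add_le x y := by
    simp only [map_add]
    exact max_le ((norm_add_le _ _).trans (add_le_add (le_max_left _ _) (le_max_left _ _)))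
      ((norm_add_le _ _).trans (add_le_add (le_max_right _ _) (le_max_right _ _)))
  smul_eq c x := by
    simp only [map_smul, norm_smul]
    rw [mul_max_of_nonneg _ _ (norm_nonneg c)]
  mul_le x y := by
    simp only [map_mul]
    exact max_le
      ((norm_mul_le _ _).trans (mul_le_mul (le_max_left _ _) (le_max_left _ _) (norm_nonneg _)
        ((norm_nonneg _).trans (le_max_left _ _))))
      ((norm_mul_le _ _).trans (mul_le_mul (le_max_right _ _) (le_max_right _ _) (norm_nonneg _)
        ((norm_nonneg _).trans (le_max_left _ _))))
  star_mul_self x := by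
    simp only [map_mul, map_star, CStarRing.norm_star_mul_self, ← pow_two]
    rcases le_total ‖vertexPi E 0 x‖ ‖vertexPi E 1 x‖ with h | h
    · rw [max_eq_right h, max_eq_right (pow_le_pow_left₀ (norm_nonneg _) h 2)]
    · rw [max_eq_left h, max_eq_left (pow_le_pow_left₀ (norm_nonneg _) h 2)]

/-- The vertex-reduced amalgamated free product `A_v`: separation and completion of `A_f` with
respect to `‖·‖_v`. -/
def VertexProduct : Type u := (vertexSeminorm E).Completion

noncomputable instance : CStarAlgebra (VertexProduct E) :=
  inferInstanceAs (CStarAlgebra (vertexSeminorm E).Completion)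
noncomputable instance : PartialOrder (VertexProduct E) := CStarAlgebra.spectralOrder _
noncomputable instance : StarOrderedRing (VertexProduct E) := CStarAlgebra.spectralOrderedRing _

/-- The canonical `⋆`-homomorphism `π : A_f → A_v`. -/
noncomputable def toVertex : FullProduct ι →⋆ₐ[ℂ] VertexProduct E :=
  (vertexSeminorm E).toCompletion

/-- The product in an algebra `D` of the images of the letters of a word. -/
def wordProd {D : Type w} [Monoid D] (ν : ∀ k, A k → D) (s : List (Σ k, A k)) : D :=
  (s.map fun x => ν x.1 x.2).prod

/-- `a = a₁ ⋯ aₙ ∈ A_f` is a reduced operator: `n ≥ 1`, `a ≠ 0`, the indices alternate and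
`aⱼ ≠ 0`, `E aⱼ = 0` for every `j`. -/
structure IsReducedWord (s : List (Σ k, A k)) : Prop where
  ne_nil : s ≠ []
  alternating : (s.map Sigma.fst).IsChain (· ≠ ·)
  centred : ∀ x ∈ s, E x.1 x.2 = 0
  letter_ne : ∀ x ∈ s, x.2 ≠ 0
  ne_zero : wordProd (fun k => inFull ι k) s ≠ 0

/-- The reduced operators on which the map onto `A k` has to vanish: either `n ≥ 2`, or `n = 1` and
the only letter does not belong to `A k`. -/
def IsReducedAway (k : Fin 2) (s : List (Σ k, A k)) : Prop :=
  IsReducedWord E s ∧ (2 ≤ s.length ∨ ∃ j, j ≠ k ∧ ∃ a : A j, s = [⟨j, a⟩])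

/-- For `⋆`-homomorphisms `ν_0, ν_1` of `A 0, A 1` into `C`: a ucp map `F : C → A k` with
`F ∘ ν_k = id` which vanishes on the products of the letters of the above reduced operators. -/
structure IsVertexMap {C : Type w} [CStarAlgebra C] [PartialOrder C] [StarOrderedRing C]
    (ν : ∀ k, A k → C) (k : Fin 2) (F : C →CP A k) : Prop where
  map_one : F 1 = 1
  map_incl : ∀ a, F (ν k a) = a
  vanish : ∀ s, IsReducedAway E k s → F (wordProd ν s) = 0

end VertexProduct

/-!
Let `e_k` be the unit of the summand `A k` of `H_{k,k}`. The vertex map onto `A k` is the vector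
state `x ↦ ⟪e_k, π_k(x) e_k⟫` (`vertexState`, and `fullState` for its restriction to `A_f`). It is
completely positive because its kernel `(x, y) ↦ ⟪π_k(x) e_k, π_k(y) e_k⟫` is positive definite
(`CompletelyPositiveMap.ofKernel`).

The computation behind everything is `vertexPi_wordProd_vacuum`: a product of centred letters with
alternating indices, ending in a letter not of type `k`, maps `e_k` to the corresponding elementary
tensor, with `η` put in front if the first letter is not of type `k`. Hence `vertexState` vanishes
on the reduced operators on which it has to (`fullState_wordProd`), and `e_k` is cyclic for `π_k`.
Cyclicity shows that the GNS representation of `vertexState` at `k` has the same kernel as `π_k`, so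
that the two vertex states are GNS-faithful (`gnsFaithful_vertexState`).

Conversely, elements `b a₁ ⋯ aₙ` with `b ∈ B` and `a₁ ⋯ aₙ` an alternating word of centred letters
span a dense subspace of `A_f` (`dense_span_centredProducts`), and the values of a vertex map there
are prescribed. So, for any C⋆-algebra `C` which receives `A_f` and carries a vertex map `F` onto
`A k`, the pullback of `F` to `A_f` is `fullState` (`IsVertexMap.apply_eq_fullState`). This gives
uniqueness. If moreover the vertex maps of `C` are GNS-faithful and `A_f → C` has dense range, then
`x` is in the kernel of `A_f → C` exactly when `fullState E k (y⋆ x z) = 0` for all `k, y, z`: the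
kernel does not depend on `C`, and in particular equals the kernel of `A_f → A_v`. Since
`⋆`-homomorphisms of C⋆-algebras with equal kernels have equal norms, `A_v` and `C` are completions
of `A_f` in the same seminorm.

The `⋆`-homomorphisms `ν k` into `C` are not assumed unital, but `1 - ν k 1` is killed by the GNS
representations of the vertex maps, hence is zero (`map_one_of_gnsFaithful`). The universal property
of `A_f` extends to C⋆-algebras in any universe (`fullLift'`), since the image of `A_f` has a copy
in the universe of `A 0` and `A 1`.
-/

/-! ### Positivity of matrices and complete positivity -/

section MatrixPositivity

variable {A C : Type*} [CStarAlgebra A] [PartialOrder A] [StarOrderedRing A]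
  [CStarAlgebra C] [PartialOrder C] [StarOrderedRing C]

/-- `CStarAlgebra.nonneg_iff_eq_star_mul_self` without its instance arguments for the functional
calculus, which are not found for `CStarMatrix`. -/
theorem CStarAlgebra.exists_eq_star_mul_self {a : A} (ha : 0 ≤ a) : ∃ s, a = star s * s :=
  CStarAlgebra.nonneg_iff_eq_star_mul_self.mp ha

/-- With `N` the negative part of `a`, `N⋆ a N = -N³` is minus a square. -/
theorem CStarAlgebra.nonneg_of_conjugate {a : A} (ha : IsSelfAdjoint a)
    (h : ∀ N S : A, star N * a * N = -(star S * S) → S = 0) : 0 ≤ a := by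
  have hN : 0 ≤ a⁻ := CFC.negPart_nonneg a
  have hNs : star a⁻ = a⁻ := (IsSelfAdjoint.of_nonneg hN).star_eq
  have h1 : a⁻ * a * a⁻ = -(a⁻ * a⁻ * a⁻) := by
    have e : a⁻ * a = a⁻ * (a⁺ - a⁻) := by rw [CFC.posPart_sub_negPart a ha]
    rw [e, mul_sub, CFC.negPart_mul_posPart, zero_sub, neg_mul]
  have h2 : 0 ≤ a⁻ * a⁻ * a⁻ := by
    have := star_left_conjugate_nonneg hN a⁻
    rwa [hNs] at this
  obtain ⟨S, hS⟩ := CStarAlgebra.nonneg_iff_eq_star_mul_self.mp h2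
  have h3 : S = 0 := h a⁻ S (by rw [hNs, h1, hS])
  have h4 : a⁻ * a⁻ * a⁻ = 0 := by rw [hS, h3, mul_zero]
  have h5 : a⁻ * a⁻ = 0 := by
    rw [← CStarRing.star_mul_self_eq_zero_iff, star_mul, hNs, ← mul_assoc, h4, zero_mul]
  have h6 : a⁻ = 0 := by
    rw [← CStarRing.star_mul_self_eq_zero_iff, hNs, h5]
  exact (CFC.negPart_eq_zero_iff a ha).mp h6

/-- The converse of `CStarMatrix.quadratic_nonneg`. -/
theorem CStarMatrix.nonneg_of_quadratic {n : Type*} [Fintype n] {M : CStarMatrix n n A}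
    (hM : IsSelfAdjoint M) (h : ∀ a : n → A, 0 ≤ ∑ i, ∑ j, star (a i) * M i j * a j) : 0 ≤ M := by
  classical
  refine CStarAlgebra.nonneg_of_conjugate hM fun N S hNS => ?_
  ext l k
  have e1 : 0 ≤ (star N * M * N) k k := by
    convert h fun i => N i k using 1
    rw [mul_assoc]
    simp only [CStarMatrix.mul_apply, CStarMatrix.star_apply, Finset.mul_sum, mul_assoc]
  have e2 : (star S * S) k k = ∑ i, star (S i k) * S i k := by
    simp [CStarMatrix.mul_apply, CStarMatrix.star_apply]
  rw [hNS, CStarMatrix.neg_apply, e2, Left.nonneg_neg_iff] at e1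
  have e3 := (Finset.sum_eq_zero_iff_of_nonneg fun i _ => star_mul_self_nonneg (S i k)).mp
    (le_antisymm e1 (Finset.sum_nonneg fun i _ => star_mul_self_nonneg (S i k))) l
      (Finset.mem_univ l)
  exact (CStarRing.star_mul_self_eq_zero_iff _).mp e3

/-- A `⋆`-preserving linear map whose kernel `(x, y) ↦ φ(x⋆ y)` is positive definite is completely
positive. -/
def CompletelyPositiveMap.ofKernel (φ : C →ₗ[ℂ] A) (hs : ∀ x, φ (star x) = star (φ x))
    (h : ∀ (k : ℕ) (x : Fin k → C) (a : Fin k → A),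
      0 ≤ ∑ i, ∑ j, star (a i) * φ (star (x i) * x j) * a j) : C →CP A where
  toLinearMap := φ
  map_cstarMatrix_nonneg' k M hM := by
    obtain ⟨S, rfl⟩ := CStarAlgebra.exists_eq_star_mul_self hM
    refine CStarMatrix.nonneg_of_quadratic ?_ fun a => ?_
    · ext i j
      simp only [CStarMatrix.star_apply, CStarMatrix.map_apply, CStarMatrix.mul_apply, ← hs]
      simp
    · have e : ∑ i, ∑ j, star (a i) * (star S * S).map φ i j * a j =
          ∑ l, ∑ i, ∑ j, star (a i) * φ (star (S l i) * S l j) * a j := by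
        simp only [CStarMatrix.map_apply, CStarMatrix.mul_apply, CStarMatrix.star_apply, map_sum,
          Finset.sum_mul, Finset.mul_sum]
        calc _ = ∑ i, ∑ l, ∑ j, star (a i) * φ (star (S l i) * S l j) * a j :=
              Finset.sum_congr rfl fun i _ => Finset.sum_comm
          _ = _ := Finset.sum_comm
      rw [e]
      exact Finset.sum_nonneg fun l _ => h k (S l) a

end MatrixPositivity

/-! ### Kernels of `⋆`-homomorphisms and of GNS representations -/

section Kernels

/-- The kernel of a `⋆`-homomorphism determines its norm: if `‖ψ h‖ > ‖φ h‖` for some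
`h = x⋆ x`, a continuous function vanishing on `(-∞, ‖φ h‖]` but not at `‖ψ h‖`, applied to `h`,
gives an element which `φ` kills and `ψ` does not. -/
theorem StarAlgHom.norm_apply_le_of_ker_le {A C D : Type*} [CStarAlgebra A] [CStarAlgebra C]
    [CStarAlgebra D] (φ : A →⋆ₐ[ℂ] C) (ψ : A →⋆ₐ[ℂ] D) (hker : ∀ x, φ x = 0 → ψ x = 0) (x : A) :
    ‖ψ x‖ ≤ ‖φ x‖ := by
  rcases subsingleton_or_nontrivial D with hD | hD
  · rw [Subsingleton.elim (ψ x) 0, norm_zero]; exact norm_nonneg _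
  let _ := CStarAlgebra.spectralOrder A
  let _ := CStarAlgebra.spectralOrderedRing A
  let _ := CStarAlgebra.spectralOrder C
  let _ := CStarAlgebra.spectralOrderedRing C
  let _ := CStarAlgebra.spectralOrder D
  let _ := CStarAlgebra.spectralOrderedRing D
  have hφ : Continuous φ := by fun_prop
  have hψ : Continuous ψ := by fun_prop
  set h := star x * x with hh
  have hsa : IsSelfAdjoint h := IsSelfAdjoint.star_mul_self x
  suffices key : ‖ψ h‖ ≤ ‖φ h‖ by
    rw [hh, map_mul, map_mul, map_star, map_star, CStarRing.norm_star_mul_self,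
      CStarRing.norm_star_mul_self] at key
    exact abs_le_of_sq_le_sq' (by simpa only [pow_two] using key) (norm_nonneg _) |>.2
  let f : ℝ → ℝ := fun t => max (t - ‖φ h‖) 0
  have hf : Continuous f := by fun_prop
  have h1 : φ (cfc f h) = 0 := by
    rcases subsingleton_or_nontrivial C with hC | hC
    · exact Subsingleton.elim _ _
    rw [StarAlgHom.map_cfc φ f h hf.continuousOn hφ hsa (hsa.map φ)]
    rw [← cfc_const_zero ℝ (φ h)]
    refine cfc_congr fun t ht => max_eq_right (sub_nonpos.mpr ?_)
    exact (le_abs_self t).trans (spectrum.norm_le_norm_of_mem ht)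
  have h2 := hker _ h1
  rw [StarAlgHom.map_cfc ψ f h hf.continuousOn hψ hsa (hsa.map ψ)] at h2
  have hpos : 0 ≤ ψ h := by rw [hh, map_mul, map_star]; exact star_mul_self_nonneg _
  have h3 : ‖ψ h‖ ∈ spectrum ℝ (ψ h) := CStarAlgebra.norm_mem_spectrum_of_nonneg hpos
  have h4 : f ‖ψ h‖ ∈ spectrum ℝ (cfc f (ψ h)) := by
    rw [cfc_map_spectrum f (ψ h) (hsa.map ψ) hf.continuousOn]
    exact ⟨_, h3, rfl⟩
  rw [h2, spectrum.zero_eq, Set.mem_singleton_iff] at h4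
  exact sub_nonpos.mp (max_eq_right_iff.mp h4)

variable {A C : Type*} [CStarAlgebra A] [PartialOrder A] [StarOrderedRing A]
  [CStarAlgebra C] [PartialOrder C] [StarOrderedRing C]

@[simp] theorem gnsKernel_toFun (φ : C →CP A) (x y : C) :
    (gnsKernel φ).toFun x y = φ (star x * y) := rfl

@[simp] theorem gnsAction_act (φ : C →CP A) (c x : C) :
    (gnsAction φ).act c x = (gnsKernel φ).single (c * x) 1 := rfl

theorem gnsRep_eq_zero_iff (φ : C →CP A) (c : C) :
    gnsRep φ c = 0 ↔ ∀ x y, φ (star x * c * y) = 0 := by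
  have e (x y : C) : (gnsKernel φ).innerSL ((gnsKernel φ).toHilb ((gnsKernel φ).single x 1))
      ((gnsRep φ c).1 ((gnsKernel φ).toHilb ((gnsKernel φ).single y 1))) =
        φ (star x * c * y) := by
    change (gnsKernel φ).innerSL _ ((gnsAction φ).op c _) = _
    rw [PosKernel.Action.op_toHilb, PosKernel.innerSL_toHilb, PosKernel.lift_single]
    simp [mul_assoc]
  constructor
  · intro h x y
    rw [← e, h]
    exact map_zero _
  · intro h
    refine Subtype.ext (PosKernel.Action.op_ext fun f => ?_)
    change (gnsAction φ).op c _ = 0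
    rw [PosKernel.Action.op_toHilb, ← map_zero (gnsKernel φ).toHilb]
    refine PosKernel.toHilb_eq_of_form fun g => ?_
    rw [PosKernel.form_zero_right]
    induction f using PosKernel.pre_induction with
    | h0 => simp
    | ha f f' hf hf' => rw [map_add, PosKernel.form_add_right, hf, hf', add_zero]
    | hs y a =>
      induction g using PosKernel.pre_induction with
      | h0 => simp
      | ha g g' hg hg' => rw [PosKernel.form_add_left, hg, hg', add_zero]
      | hs x b =>
        have := h x y
        rw [mul_assoc] at this
        simp [PosKernel.lift_single, PosKernel.form_smul_right, this]

end Kernels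

/-! ### The universal property of the full product in all universes -/

section FullLift

variable {A : Fin 2 → Type u} [∀ k, CStarAlgebra (A k)] {B : Type v} [CStarAlgebra B]
  {ι : ∀ k, B →⋆ₐ[ℂ] A k} {D : Type w} [CStarAlgebra D]

/-- The C⋆-seminorm `x ↦ ‖φ x‖` on the free `⋆`-algebra. -/
noncomputable def evalSeminorm (φ : ∀ k, A k →⋆ₐ[ℂ] D) : CStarSeminorm (FreeStar A) where
  toFun x := ‖FreeStar.eval φ x‖
  add_le x y := by rw [map_add]; exact norm_add_le _ _
  smul_eq c x := by rw [map_smul, norm_smul]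
  mul_le x y := by rw [map_mul]; exact norm_mul_le _ _
  star_mul_self x := by rw [map_mul, map_star, CStarRing.norm_star_mul_self, pow_two]

/-- The C⋆-algebra generated by the images of `A 0` and `A 1` is a completion of the free
`⋆`-algebra, so it has a copy in the universe of `A 0` and `A 1`. -/
theorem norm_eval_le_fullSeminorm (φ : ∀ k, A k →⋆ₐ[ℂ] D) (h : ∀ b, φ 0 (ι 0 b) = φ 1 (ι 1 b))
    (x : FreeStar A) : ‖FreeStar.eval φ x‖ ≤ (fullSeminorm ι).toFun x := by
  let q := evalSeminorm φ
  have key {y z : FreeStar A} (e : FreeStar.eval φ y = FreeStar.eval φ z) :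
      q.toCompletion y = q.toCompletion z := q.coeC_eq (by
    change ‖FreeStar.eval φ (y - z)‖ = 0
    rw [map_sub, e, sub_self, norm_zero])
  let ψ (k : Fin 2) : A k →⋆ₐ[ℂ] q.Completion :=
    { toFun := fun a => q.toCompletion (FreeStar.letter k a)
      map_one' := by rw [← map_one q.toCompletion]; exact key (by simp)
      map_mul' := fun a b => by rw [← map_mul]; exact key (by simp)
      map_zero' := by rw [← map_zero q.toCompletion]; exact key (by simp)
      map_add' := fun a b => by rw [← map_add]; exact key (by simp)
      commutes' := fun c => by
        rw [← AlgHomClass.commutes q.toCompletion]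
        exact key (by rw [FreeStar.eval_letter, AlgHomClass.commutes, AlgHomClass.commutes])
      map_star' := fun a => by rw [← map_star]; exact key (by simp) }
  have e (y : FreeStar A) : FreeStar.eval ψ y = q.toCompletion y := by
    induction y using FreeStar.induction with
    | hc c => rw [AlgHomClass.commutes, AlgHomClass.commutes]
    | hl k a => rw [FreeStar.eval_letter]; rfl
    | hm y z hy hz => rw [map_mul, map_mul, hy, hz]
    | ha y z hy hz => rw [map_add, map_add, hy, hz]
  have e' : ‖FreeStar.eval ψ x‖ = ‖FreeStar.eval φ x‖ := by
    rw [e]; exact q.norm_coeC x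
  rw [← e']
  exact norm_eval_le ι ψ (fun b => key (by simpa using h b)) x

/-- The universal property of `A_f` for C⋆-algebras in an arbitrary universe. -/
noncomputable def fullLift' (φ : ∀ k, A k →⋆ₐ[ℂ] D) (h : ∀ b, φ 0 (ι 0 b) = φ 1 (ι 1 b)) :
    FullProduct ι →⋆ₐ[ℂ] D :=
  CStarSeminorm.lift (FreeStar.eval φ) (norm_eval_le_fullSeminorm φ h)

@[simp] theorem fullLift'_inFull (φ : ∀ k, A k →⋆ₐ[ℂ] D) (h : ∀ b, φ 0 (ι 0 b) = φ 1 (ι 1 b))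
    (k : Fin 2) (a : A k) : fullLift' φ h (inFull ι k a) = φ k a := by
  change fullLift' φ h ((fullSeminorm ι).toCompletion (FreeStar.letter k a)) = _
  unfold fullLift'
  rw [CStarSeminorm.lift_toCompletion, FreeStar.eval_letter]

end FullLift

/-! ### The vacuum vector and the vertex states -/

section VertexState

theorem PosKernel.innerSL_adjointable {A X : Type*} [CStarAlgebra A] [PartialOrder A]
    [StarOrderedRing A] {K : PosKernel A X} (T : Adjointable Aᵐᵒᵖ K.Hilb) (x y : K.Hilb) :
    K.innerSL (T.1 x) y = K.innerSL x ((star T).1 y) :=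
  congrArg unop (Adjointable.inner_left T x y)

theorem PosKernel.innerSL_smul_left {A X : Type*} [CStarAlgebra A] [PartialOrder A]
    [StarOrderedRing A] (K : PosKernel A X) (a : Aᵐᵒᵖ) (x y : K.Hilb) :
    K.innerSL (a • x) y = star (unop a) * K.innerSL x y := by
  rw [← K.star_innerSL, K.innerSL_smul_right, star_mul, K.star_innerSL]

theorem PosKernel.adjointable_smul {A X : Type*} [CStarAlgebra A] [PartialOrder A]
    [StarOrderedRing A] {K : PosKernel A X} (T : Adjointable Aᵐᵒᵖ K.Hilb) (a : Aᵐᵒᵖ)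
    (x : K.Hilb) : T.1 (a • x) = a • T.1 x := by
  refine K.hilb_ext fun z => ?_
  rw [← star_star T, ← K.innerSL_adjointable, K.innerSL_smul_right, K.innerSL_smul_right,
    ← K.innerSL_adjointable]

variable {A : Fin 2 → Type u} [∀ k, CStarAlgebra (A k)] [∀ k, PartialOrder (A k)]
  [∀ k, StarOrderedRing (A k)] {B : Type v} [CStarAlgebra B] [PartialOrder B] [StarOrderedRing B]
  {ι : ∀ k, B →⋆ₐ[ℂ] A k} (E : ∀ k, CondExp (ι k))

/-- The unit `1` of the summand `A k` of `H_{k,k}`. -/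
noncomputable def vacuum (k : Fin 2) : VertexModule E k k :=
  (vertexKernel E k k).toHilb ((vertexKernel E k k).single (.nil k) 1)

/-- The map `x ↦ ⟪1, π_k(x) 1⟫` from `A_f` to `A k`, where `1` is the unit of the summand `A k` of
`H_{k,k}`. -/
noncomputable def fullState (k : Fin 2) : FullProduct ι →ₗ[ℂ] A k where
  toFun x := (vertexKernel E k k).innerSL (vacuum E k) ((vertexPi E k x).1 (vacuum E k))
  map_add' x y := by
    rw [map_add]
    exact map_add ((vertexKernel E k k).innerSL (vacuum E k)) _ _
  map_smul' c x := by
    rw [map_smul]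
    exact map_smul ((vertexKernel E k k).innerSL (vacuum E k)) _ _

/-- The representation `π_k` as a representation of `A_v`. -/
noncomputable def vertexProductRep (k : Fin 2) :
    VertexProduct E →⋆ₐ[ℂ] Adjointable (A k)ᵐᵒᵖ (VertexModule E k k) :=
  CStarSeminorm.lift (q := vertexSeminorm E) (vertexPi E k) fun x => by
    change _ ≤ max _ _
    fin_cases k
    · exact le_max_left _ _
    · exact le_max_right _ _

@[simp] theorem vertexProductRep_toVertex (k : Fin 2) (x : FullProduct ι) :
    vertexProductRep E k (toVertex E x) = vertexPi E k x :=
  CStarSeminorm.lift_toCompletion _ _ x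

theorem norm_toVertex (x : FullProduct ι) :
    ‖toVertex E x‖ = max ‖vertexPi E 0 x‖ ‖vertexPi E 1 x‖ :=
  (vertexSeminorm E).norm_coeC x

theorem denseRange_toVertex : DenseRange (toVertex E) := (vertexSeminorm E).denseRange_coeC

/-- The ucp map `x ↦ ⟪1, π_k(x) 1⟫` from `A_v` to `A k`. -/
noncomputable def vertexState (k : Fin 2) : VertexProduct E →CP A k :=
  CompletelyPositiveMap.ofKernel
    { toFun := fun x =>
        (vertexKernel E k k).innerSL (vacuum E k) ((vertexProductRep E k x).1 (vacuum E k))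
      map_add' := fun x y => by
        rw [map_add]
        exact map_add ((vertexKernel E k k).innerSL (vacuum E k)) _ _
      map_smul' := fun c x => by
        rw [map_smul]
        exact map_smul ((vertexKernel E k k).innerSL (vacuum E k)) _ _ }
    (fun x => by
      change (vertexKernel E k k).innerSL _ _ = star ((vertexKernel E k k).innerSL _ _)
      rw [PosKernel.star_innerSL, map_star, PosKernel.innerSL_adjointable])
    (fun n x a => by
      have e := (vertexKernel E k k).innerSL_self_nonneg
        (∑ i, op (a i) • (vertexProductRep E k (x i)).1 (vacuum E k))
      convert e using 1
      simp only [map_sum, FunLike.coe_sum, Finset.sum_apply]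
      rw [Finset.sum_comm]
      refine Finset.sum_congr rfl fun i _ => Finset.sum_congr rfl fun j _ => ?_
      change _ * (vertexKernel E k k).innerSL _ ((vertexProductRep E k _).1 _) * _ = _
      rw [PosKernel.innerSL_smul_right, PosKernel.innerSL_smul_left,
        PosKernel.innerSL_adjointable, map_mul, map_star]
      rfl)

@[simp] theorem vertexState_toVertex (k : Fin 2) (x : FullProduct ι) :
    vertexState E k (toVertex E x) = fullState E k x := by
  change (vertexKernel E k k).innerSL _ ((vertexProductRep E k (toVertex E x)).1 _) = _
  rw [vertexProductRep_toVertex]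
  rfl

theorem vertexPi_inFull (k j : Fin 2) (a : A j) :
    vertexPi E k (inFull ι j a) = vertexRep E k j a := fullLift_inFull _ _ j a

theorem vertexRep_same (k : Fin 2) (a : A k) : vertexRep E k k a = leftRep E k k a := by
  simp [vertexRep]

theorem vertexRep_apply_of_ne {k j : Fin 2} (h : k ≠ j) (a : A j) (x : VertexModule E k k) :
    (vertexRep E k j a).1 x =
      vertexFlipL E h.symm k ((leftRep E j k a).1 (vertexFlipL E h k x)) := by
  simp only [vertexRep, dif_neg h]
  rfl

theorem leftRep_toHilb_single {k l : Fin 2} (a : A k) (v : Elem E k l) :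
    (leftRep E k l a).1 ((vertexKernel E k l).toHilb ((vertexKernel E k l).single v 1)) =
      (vertexKernel E k l).toHilb (leftMul a v) := by
  change (leftAction E k l).op a _ = _
  rw [PosKernel.Action.op_toHilb, PosKernel.lift_single, op_one, one_smul]
  rfl

theorem vertexPi_inFull_vacuum (k : Fin 2) (a : A k) :
    (vertexPi E k (inFull ι k a)).1 (vacuum E k) = op a • vacuum E k := by
  rw [vertexPi_inFull, vertexRep_same, vacuum, leftRep_toHilb_single, leftMul_nil,
    ← PosKernel.toHilb_smul, PosKernel.smul_single, one_mul]

theorem innerSL_vacuum (k : Fin 2) (v : Elem E k k) :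
    (vertexKernel E k k).innerSL (vacuum E k)
      ((vertexKernel E k k).toHilb ((vertexKernel E k k).single v 1)) =
        ι k (wordForm E 1 [] v.toList) := by
  rw [vacuum, PosKernel.innerSL_toHilb]
  simp

theorem fullState_inFull (k : Fin 2) (a : A k) : fullState E k (inFull ι k a) = a := by
  change (vertexKernel E k k).innerSL _ ((vertexPi E k _).1 _) = _
  rw [vertexPi_inFull_vacuum, PosKernel.innerSL_smul_right]
  have e := innerSL_vacuum E k (.nil k)
  rw [← vacuum] at e
  rw [e]
  simp [wordForm]

/-- The unitaries `u_{k,l}` prepend `η` to tensors that begin with a centred letter. -/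
theorem vertexFlipL_cons {k k' l : Fin 2} (h : k ≠ k') (x : A k) (hx : E k x = 0)
    (t : Middle E k l) (t' : Middle E k' l) (ht : t'.list = ⟨k, x⟩ :: t.list) :
    vertexFlipL E h l ((vertexKernel E k l).toHilb ((vertexKernel E k l).single (.cons x t) 1)) =
      (vertexKernel E k' l).toHilb ((vertexKernel E k' l).single (.cons 1 t') 1) := by
  rw [vertexFlipL_toHilb, PosKernel.lift_single, op_one, one_smul, vertexFlip_cons, map_add]
  have e1 : (vertexKernel E k' l).toHilb (leftMul (ι k' (E k x)) (Elem.ofMiddle h t)) = 0 := by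
    rw [← leftRep_toHilb_single, hx, map_zero, map_zero]
    rfl
  have e2 : padded h x t = .cons 1 t' := by
    obtain ⟨s', hs, hs'⟩ := t'
    subst ht
    simp [padded, hx]
  rw [e1, e2, add_zero]

theorem vertexFlipL_ofMiddle {k k' l : Fin 2} (h : k ≠ k') (t : Middle E k' l) :
    vertexFlipL E h l ((vertexKernel E k l).toHilb
      ((vertexKernel E k l).single (Elem.ofMiddle h.symm t) 1)) =
      (vertexKernel E k' l).toHilb ((vertexKernel E k' l).single (.cons 1 t) 1) := by
  obtain ⟨_ | ⟨⟨j, y⟩, s⟩, hc, hz⟩ := t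
  · have e : l = k := Elem.fin_two_eq h.symm (by simpa using hc)
    subst e
    change vertexFlipL E h l (PosKernel.toHilb _ (PosKernel.single _ (.nil l) 1)) = _
    rw [vertexFlipL_toHilb, PosKernel.lift_single, op_one, one_smul, vertexFlip_nil]
  · have e : j = k := Elem.fin_two_eq h.symm (by simp at hc; exact hc.1)
    subst e
    exact vertexFlipL_cons E h y (hz ⟨j, y⟩ (by simp)) _ _ rfl

variable {E} in
/-- The generator of `H_{k,k}` given by a centred tensor which may follow a letter of type `j`: if
its first letter is not of type `k`, then `η` is put in front of it. -/
noncomputable def Middle.toElem {j k : Fin 2} (t : Middle E j k) : Elem E k k :=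
  if h : j = k then .cons 1 ⟨t.list, by simpa only [h] using t.chain, t.centred⟩
  else Elem.ofMiddle h t

theorem Middle.toElem_same {k : Fin 2} (t : Middle E k k) : t.toElem = .cons 1 t := by
  simp [Middle.toElem]

theorem Middle.toElem_of_ne {j k : Fin 2} (h : j ≠ k) (t : Middle E j k) :
    t.toElem = Elem.ofMiddle h t := by
  simp [Middle.toElem, h]

theorem Middle.toList_toElem_ne_nil {j k : Fin 2} (t : Middle E j k) (ht : t.list ≠ []) :
    t.toElem.toList ≠ [] := by
  by_cases h : j = k
  · subst h; simp [Middle.toElem_same]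
  · simpa [Middle.toElem_of_ne E h] using ht

/-- The product of the letters of a centred tensor `t` maps the vacuum vector to `t`. -/
theorem vertexPi_wordProd_vacuum {j k : Fin 2} (t : Middle E j k) :
    (vertexPi E k (wordProd (fun k => inFull ι k) t.list)).1 (vacuum E k) =
      (vertexKernel E k k).toHilb ((vertexKernel E k k).single t.toElem 1) := by
  obtain ⟨s, hc, hz⟩ := t
  induction s generalizing j with
  | nil =>
    have h : j ≠ k := by simpa using hc
    rw [Middle.toElem_of_ne E h]
    simp [wordProd, vacuum, Elem.ofMiddle]
  | cons y s ih =>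
    obtain ⟨i, a⟩ := y
    have hc' : (i :: (s.map Sigma.fst ++ [k])).IsChain (· ≠ ·) := by simp at hc ⊢; exact hc.2
    have hz' : ∀ x ∈ s, E x.1 x.2 = 0 := fun x hx => hz x (List.mem_cons_of_mem _ hx)
    have hji : j ≠ i := by simp at hc; exact hc.1
    have e : wordProd (fun k => inFull ι k) (⟨i, a⟩ :: s) =
        inFull ι i a * wordProd (fun k => inFull ι k) s := by simp [wordProd]
    dsimp only at ih ⊢
    rw [e, map_mul, vertexPi_inFull]
    change (vertexRep E k i a).1 ((vertexPi E k _).1 (vacuum E k)) = _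
    rw [ih hc' hz']
    by_cases h : i = k
    · subst h
      rw [vertexRep_same, Middle.toElem_same, leftRep_toHilb_single, leftMul_cons, mul_one,
        Middle.toElem_of_ne E hji]
      rfl
    · have e : j = k := Elem.fin_two_eq h (Ne.symm hji)
      subst e
      rw [Middle.toElem_of_ne E h, vertexRep_apply_of_ne E hji, vertexFlipL_ofMiddle,
        leftRep_toHilb_single, leftMul_cons, mul_one, Middle.toElem_same]
      exact vertexFlipL_cons E h a (hz ⟨i, a⟩ (by simp)) _ _ rfl

end VertexState

/-! ### Values of the vertex states on words -/

section Words

variable {A : Fin 2 → Type u} [∀ k, CStarAlgebra (A k)] [∀ k, PartialOrder (A k)]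
  [∀ k, StarOrderedRing (A k)] {B : Type v} [CStarAlgebra B] [PartialOrder B] [StarOrderedRing B]
  {ι : ∀ k, B →⋆ₐ[ℂ] A k} (E : ∀ k, CondExp (ι k))

/-- An alternating word of centred letters; the empty word is allowed, and the product of the
letters may vanish. -/
structure IsCentredWord (s : List (Σ k, A k)) : Prop where
  alternating : (s.map Sigma.fst).IsChain (· ≠ ·)
  centred : ∀ x ∈ s, E x.1 x.2 = 0

variable {E}

theorem IsCentredWord.tail {x : Σ k, A k} {s : List (Σ k, A k)} (h : IsCentredWord E (x :: s)) :
    IsCentredWord E s where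
  alternating := by have := h.alternating; rw [List.map_cons] at this; exact this.tail
  centred y hy := h.centred y (List.mem_cons_of_mem _ hy)

theorem IsCentredWord.cons {j : Fin 2} {a : A j} (ha : E j a = 0) {s : List (Σ k, A k)}
    (hs : IsCentredWord E s) (hj : ∀ x ∈ s.head?, j ≠ x.1) : IsCentredWord E (⟨j, a⟩ :: s) where
  alternating := by
    rw [List.map_cons, List.isChain_cons]
    refine ⟨?_, hs.alternating⟩
    cases s <;> simp_all
  centred := by
    simpa using ⟨ha, hs.centred⟩

theorem wordProd_cons {D : Type*} [Monoid D] (ν : ∀ k, A k → D) (k : Fin 2) (a : A k)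
    (s : List (Σ k, A k)) : wordProd ν (⟨k, a⟩ :: s) = ν k a * wordProd ν s := by
  simp [wordProd]

theorem map_wordProd {D D' F : Type*} [Monoid D] [Monoid D'] [FunLike F D D']
    [MonoidHomClass F D D'] (φ : F) (ν : ∀ k, A k → D) (s : List (Σ k, A k)) :
    φ (wordProd ν s) = wordProd (fun k a => φ (ν k a)) s := by
  simp only [wordProd, map_list_prod, List.map_map]
  rfl

theorem Fin.exists_isChain_ne_cons (L : List (Fin 2)) (h : L.IsChain (· ≠ ·)) :
    ∃ j, (j :: L).IsChain (· ≠ ·) := by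
  cases L with
  | nil => exact ⟨0, by simp⟩
  | cons i L =>
    obtain ⟨j, hj⟩ := exists_ne i
    exact ⟨j, by rw [List.isChain_cons_cons]; exact ⟨hj, h⟩⟩

theorem fullState_wordProd {k : Fin 2} {s : List (Σ k, A k)} (hs : IsCentredWord E s)
    (h : 2 ≤ s.length ∨ ∃ j, j ≠ k ∧ ∃ a : A j, s = [⟨j, a⟩]) :
    fullState E k (wordProd (fun k => inFull ι k) s) = 0 := by
  have hne : s ≠ [] := by
    rintro rfl
    simp at h
  -- A word is a centred tensor followed by an element of `A k`, which is `1` if the last letter is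
  -- not of type `k`.
  obtain ⟨j, t, c, hc, ht⟩ : ∃ (j : Fin 2) (t : Middle E j k) (c : A k),
      wordProd (fun k => inFull ι k) s = wordProd (fun k => inFull ι k) t.list * inFull ι k c ∧
        t.list ≠ [] := by
    obtain ⟨s', ⟨i, c⟩, rfl⟩ := List.eq_nil_or_concat' s |>.resolve_left hne
    obtain ⟨halt, hcen⟩ := hs
    by_cases hi : i = k
    · subst hi
      rw [List.map_append, List.map_singleton] at halt
      obtain ⟨j, hj⟩ := Fin.exists_isChain_ne_cons _ halt
      refine ⟨j, ⟨s', hj, fun x hx => hcen x (List.mem_append_left _ hx)⟩, c, by simp [wordProd],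
        ?_⟩
      rintro rfl
      rcases h with h | ⟨j, hj, a, e⟩
      · simp at h
      · simp at e
        exact hj e.1.symm
    · have halt' : ((s' ++ [(⟨i, c⟩ : Σ k, A k)]).map Sigma.fst ++ [k]).IsChain (· ≠ ·) := by
        rw [List.isChain_append]
        refine ⟨halt, by simp, ?_⟩
        simpa using hi
      obtain ⟨j, hj⟩ := Fin.exists_isChain_ne_cons _ halt'
      exact ⟨j, ⟨_, hj, hcen⟩, 1, by simp, by simp⟩
  change (vertexKernel E k k).innerSL _ ((vertexPi E k _).1 _) = _
  rw [hc, map_mul]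
  change (vertexKernel E k k).innerSL _ ((vertexPi E k _).1 ((vertexPi E k _).1 _)) = _
  rw [vertexPi_inFull_vacuum, PosKernel.adjointable_smul, PosKernel.innerSL_smul_right,
    vertexPi_wordProd_vacuum, innerSL_vacuum]
  have e := Middle.toList_toElem_ne_nil E t ht
  cases hl : t.toElem.toList with
  | nil => exact absurd hl e
  | cons y r => simp [wordForm]

theorem fullState_one (k : Fin 2) : fullState E k 1 = 1 := by
  rw [← map_one (inFull ι k), fullState_inFull]

variable (E) in
/-- Elements `b a₁ ⋯ aₙ` of `A_f` with `b ∈ B`, `n ≥ 0` and `a₁ ⋯ aₙ` an alternating word of centred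
letters. -/
def centredProducts : Set (FullProduct ι) :=
  {x | ∃ b s, IsCentredWord E s ∧ x = inFull ι 0 (ι 0 b) * wordProd (fun k => inFull ι k) s}

theorem inFull_incl_eq (j : Fin 2) (b : B) : inFull ι j (ι j b) = inFull ι 0 (ι 0 b) := by
  fin_cases j
  · rfl
  · exact (inFull_incl ι b).symm

theorem inFull_mul_wordProd_mem_span (j : Fin 2) (a : A j) {s : List (Σ k, A k)}
    (hs : IsCentredWord E s) :
    inFull ι j a * wordProd (fun k => inFull ι k) s ∈ Submodule.span ℂ (centredProducts E) := by
  -- If `s` does not begin with a letter of type `j`, then `a s = (a - E a) s + (E a) s`.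
  have key (a : A j) {s : List (Σ k, A k)} (hs : IsCentredWord E s)
      (hj : ∀ x ∈ s.head?, j ≠ x.1) :
      inFull ι j a * wordProd (fun k => inFull ι k) s ∈ Submodule.span ℂ (centredProducts E) := by
    have e : inFull ι j a * wordProd (fun k => inFull ι k) s =
        inFull ι 0 (ι 0 1) * wordProd (fun k => inFull ι k) (⟨j, a - ι j (E j a)⟩ :: s) +
          inFull ι 0 (ι 0 (E j a)) * wordProd (fun k => inFull ι k) s := by
      rw [wordProd_cons, map_one, map_one, one_mul, ← inFull_incl_eq j, ← add_mul, ← map_add,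
        sub_add_cancel]
    rw [e]
    refine add_mem (Submodule.subset_span ⟨_, _, hs.cons ?_ hj, rfl⟩)
      (Submodule.subset_span ⟨_, _, hs, rfl⟩)
    rw [map_sub, (E j).map_incl, sub_self]
  by_cases hj : ∀ x ∈ s.head?, j ≠ x.1
  · exact key a hs hj
  · obtain _ | ⟨⟨i, x⟩, s⟩ := s
    · simp at hj
    · obtain rfl : j = i := by simpa using hj
      rw [wordProd_cons, ← mul_assoc, ← map_mul]
      refine key _ hs.tail ?_
      have := hs.alternating
      cases s <;> simp_all

/-- Centred products span a dense subspace of `A_f`. -/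
theorem dense_span_centredProducts :
    Dense (Submodule.span ℂ (centredProducts E) : Set (FullProduct ι)) := by
  have hmul (j : Fin 2) (a : A j) (x : FullProduct ι)
      (hx : x ∈ Submodule.span ℂ (centredProducts E)) :
      inFull ι j a * x ∈ Submodule.span ℂ (centredProducts E) := by
    induction hx using Submodule.span_induction with
    | mem x hx =>
      obtain ⟨b, s, hs, rfl⟩ := hx
      rw [← inFull_incl_eq j, ← mul_assoc, ← map_mul]
      exact inFull_mul_wordProd_mem_span j _ hs
    | zero => simp
    | add x y _ _ hx hy => rw [mul_add]; exact add_mem hx hy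
    | smul c x _ hx => rw [mul_smul_comm]; exact Submodule.smul_mem _ _ hx
  have hfree (y : FreeStar A) : ∀ x ∈ Submodule.span ℂ (centredProducts E),
      (fullSeminorm ι).toCompletion y * x ∈ Submodule.span ℂ (centredProducts E) := by
    induction y using FreeStar.induction with
    | hc c =>
      intro x hx
      rw [AlgHomClass.commutes, ← Algebra.smul_def]
      exact Submodule.smul_mem _ _ hx
    | hl k a => exact hmul k a
    | hm y z hy hz =>
      intro x hx
      rw [map_mul, mul_assoc]
      exact hy _ (hz _ hx)
    | ha y z hy hz =>
      intro x hx
      rw [map_add, add_mul]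
      exact add_mem (hy _ hx) (hz _ hx)
  refine (fullSeminorm ι).denseRange_coeC.mono ?_
  rintro _ ⟨y, rfl⟩
  have h1 : (1 : FullProduct ι) ∈ Submodule.span ℂ (centredProducts E) :=
    Submodule.subset_span ⟨1, [], ⟨by simp, by simp⟩, by simp [wordProd]⟩
  have := hfree y 1 h1
  rwa [mul_one] at this

/-- The vertex state is the only candidate for a vertex map: the values of a vertex map on the
dense subspace spanned by centred products are prescribed. -/
theorem IsVertexMap.apply_eq_fullState {D : Type w} [CStarAlgebra D] [PartialOrder D]
    [StarOrderedRing D] {ν : ∀ k, A k → D} {k : Fin 2} {F : D →CP A k} (hF : IsVertexMap E ν k F)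
    (φ : FullProduct ι →⋆ₐ[ℂ] D) (hφ : ∀ k a, φ (inFull ι k a) = ν k a) (x : FullProduct ι) :
    F (φ x) = fullState E k x := by
  have hword (s : List (Σ k, A k)) (hs : IsCentredWord E s) :
      F (φ (wordProd (fun k => inFull ι k) s)) =
        fullState E k (wordProd (fun k => inFull ι k) s) := by
    rcases s with _ | ⟨⟨i, a⟩, s⟩
    · simp [wordProd, hF.map_one, fullState_one]
    by_cases hk : i = k ∧ s = []
    · obtain ⟨rfl, rfl⟩ := hk
      simp [wordProd, hφ, hF.map_incl, fullState_inFull]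
    have haway : 2 ≤ (⟨i, a⟩ :: s : List (Σ k, A k)).length ∨
        ∃ j, j ≠ k ∧ ∃ b : A j, (⟨i, a⟩ :: s : List (Σ k, A k)) = [⟨j, b⟩] := by
      rcases s with _ | ⟨y, s⟩
      · exact .inr ⟨i, by simpa using hk, a, rfl⟩
      · exact .inl (by simp)
    rw [fullState_wordProd hs haway]
    by_cases h0 : wordProd (fun k => inFull ι k) (⟨i, a⟩ :: s) = 0
    · rw [h0, map_zero, map_zero]
    have hl : ∀ x ∈ (⟨i, a⟩ :: s : List (Σ k, A k)), x.2 ≠ 0 := by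
      intro x hx hx0
      refine h0 (List.prod_eq_zero (List.mem_map.mpr ⟨x, hx, ?_⟩))
      dsimp only
      rw [hx0, map_zero]
    have := hF.vanish _ ⟨⟨by simp, hs.alternating, hs.centred, hl, h0⟩, haway⟩
    rw [map_wordProd]
    simpa only [hφ] using this
  have hspan : Set.EqOn (fun x => F (φ x)) (fullState E k)
      (Submodule.span ℂ (centredProducts E)) := by
    intro x hx
    induction hx using Submodule.span_induction with
    | mem x hx =>
      obtain ⟨b, s, hs, rfl⟩ := hx
      dsimp only
      rcases s with _ | ⟨⟨i, a⟩, s⟩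
      · rw [← inFull_incl_eq k, wordProd, List.map_nil, List.prod_nil, mul_one, hφ, hF.map_incl,
          fullState_inFull]
      · rw [wordProd_cons, ← inFull_incl_eq i, ← mul_assoc, ← map_mul, ← wordProd_cons
          (fun k => inFull ι k)]
        refine hword _ ⟨hs.alternating, ?_⟩
        intro x hx
        rcases List.mem_cons.mp hx with rfl | hx
        · dsimp only
          rw [CondExp.apply_incl_mul, hs.centred ⟨i, a⟩ (by simp), mul_zero]
        · exact hs.centred x (List.mem_cons_of_mem _ hx)
    | zero => simp
    | add x y _ _ hx hy =>
      dsimp only at hx hy ⊢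
      rw [map_add, map_add, hx, hy, map_add]
    | smul c x _ hx =>
      dsimp only at hx ⊢
      rw [map_smul, map_smul, hx, map_smul]
  have hcont : Continuous (fullState E k) := by
    have e : ⇑(fullState E k) = fun x => vertexState E k (toVertex E x) :=
      funext fun x => (vertexState_toVertex E k x).symm
    rw [e]
    fun_prop
  have hcontF : Continuous fun x => F (φ x) := by fun_prop
  exact congrFun (hcontF.ext_on dense_span_centredProducts hcont hspan) x

variable (E) in
theorem isVertexMap_vertexState (k : Fin 2) :
    IsVertexMap E (fun j a => toVertex E (inFull ι j a)) k (vertexState E k) where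
  map_one := by rw [← map_one (toVertex E), vertexState_toVertex, fullState_one]
  map_incl a := by rw [vertexState_toVertex, fullState_inFull]
  vanish s hs := by
    rw [← map_wordProd (toVertex E) (fun j => inFull ι j), vertexState_toVertex]
    exact fullState_wordProd ⟨hs.1.alternating, hs.1.centred⟩ hs.2

end Words

/-! ### Cyclicity of the vacuum vector and kernels of the vertex representations -/

section VertexKernels

variable {A : Fin 2 → Type u} [∀ k, CStarAlgebra (A k)] [∀ k, PartialOrder (A k)]
  [∀ k, StarOrderedRing (A k)] {B : Type v} [CStarAlgebra B] [PartialOrder B] [StarOrderedRing B]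
  {ι : ∀ k, B →⋆ₐ[ℂ] A k} (E : ∀ k, CondExp (ι k))

theorem exists_vertexPi_vacuum_eq {k : Fin 2} (v : Elem E k k) : ∃ x : FullProduct ι,
    (vertexPi E k x).1 (vacuum E k) =
      (vertexKernel E k k).toHilb ((vertexKernel E k k).single v 1) := by
  cases v with
  | nil => exact ⟨1, by rw [map_one]; rfl⟩
  | cons x t =>
    refine ⟨inFull ι k x * wordProd (fun k => inFull ι k) t.list, ?_⟩
    rw [map_mul]
    change (vertexPi E k _).1 ((vertexPi E k _).1 _) = _
    rw [vertexPi_wordProd_vacuum, vertexPi_inFull, vertexRep_same, Middle.toElem_same,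
      leftRep_toHilb_single, leftMul_cons, mul_one]

/-- The vacuum vector is cyclic for `π_k`, so an operator all of whose matrix coefficients between
vectors of its orbit vanish is zero. -/
theorem adjointable_eq_zero_of_vacuum {k : Fin 2} (T : Adjointable (A k)ᵐᵒᵖ (VertexModule E k k))
    (h : ∀ x y : FullProduct ι, (vertexKernel E k k).innerSL ((vertexPi E k x).1 (vacuum E k))
      (T.1 ((vertexPi E k y).1 (vacuum E k))) = 0) : T = 0 := by
  refine Subtype.ext (PosKernel.Action.op_ext fun f => PosKernel.hilb_ext fun g => ?_)
  change _ = (vertexKernel E k k).innerSL _ 0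
  rw [map_zero]
  induction f using PosKernel.pre_induction with
  | h0 => simp
  | ha f f' hf hf' => rw [map_add, map_add, map_add, hf, hf', add_zero]
  | hs w b =>
    induction g using PosKernel.pre_induction with
    | h0 => simp
    | ha g g' hg hg' => rw [map_add, map_add, add_apply, hg, hg', add_zero]
    | hs v a =>
      obtain ⟨x, hx⟩ := exists_vertexPi_vacuum_eq E v
      obtain ⟨y, hy⟩ := exists_vertexPi_vacuum_eq E w
      have e := h x y
      rw [hx, hy] at e
      rw [PosKernel.single_eq v a, PosKernel.single_eq w b, PosKernel.toHilb_smul,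
        PosKernel.toHilb_smul, PosKernel.adjointable_smul, PosKernel.innerSL_smul_right,
        PosKernel.innerSL_smul_left, e, mul_zero, zero_mul]

theorem vertexProductRep_eq_zero {k : Fin 2} {c : VertexProduct E}
    (h : ∀ x y, vertexState E k (star x * c * y) = 0) : vertexProductRep E k c = 0 := by
  refine adjointable_eq_zero_of_vacuum E _ fun x y => ?_
  rw [← h (toVertex E x) (toVertex E y)]
  change _ = (vertexKernel E k k).innerSL _ ((vertexProductRep E k _).1 _)
  rw [map_mul, map_mul, map_star, PosKernel.innerSL_adjointable, vertexProductRep_toVertex,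
    vertexProductRep_toVertex]
  rfl

theorem norm_vertexProduct (c : VertexProduct E) :
    ‖c‖ = max ‖vertexProductRep E 0 c‖ ‖vertexProductRep E 1 c‖ := by
  have h (k : Fin 2) : Continuous (vertexProductRep E k) := by fun_prop
  refine congrFun ((denseRange_toVertex E).equalizer continuous_norm
    ((h 0).norm.max (h 1).norm) (funext fun x => ?_)) c
  simp [norm_toVertex]

theorem gnsFaithful_vertexState : GNSFaithful (vertexState E) := by
  intro c hc
  have h (k : Fin 2) : vertexProductRep E k c = 0 :=
    vertexProductRep_eq_zero E ((gnsRep_eq_zero_iff _ c).mp (hc k))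
  rw [← norm_eq_zero, norm_vertexProduct, h, h, norm_zero, norm_zero, max_self]

variable {E}

theorem IsVertexMap.eq_vertexState {k : Fin 2} {F : VertexProduct E →CP A k}
    (hF : IsVertexMap E (fun j a => toVertex E (inFull ι j a)) k F) : F = vertexState E k := by
  have h1 : Continuous F := by fun_prop
  have h2 : Continuous (vertexState E k) := by fun_prop
  refine DFunLike.coe_injective ((denseRange_toVertex E).equalizer h1 h2 (funext fun x => ?_))
  simp only [Function.comp_apply, vertexState_toVertex]
  exact hF.apply_eq_fullState (toVertex E) (fun _ _ => rfl) x

end VertexKernels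

/-! ### Characterization of the vertex-reduced product -/

section Characterization

variable {A : Fin 2 → Type u} [∀ k, CStarAlgebra (A k)] [∀ k, PartialOrder (A k)]
  [∀ k, StarOrderedRing (A k)] {B : Type v} [CStarAlgebra B] [PartialOrder B] [StarOrderedRing B]
  {ι : ∀ k, B →⋆ₐ[ℂ] A k} {E : ∀ k, CondExp (ι k)}

theorem FullProduct.hom_ext {D : Type*} [CStarAlgebra D] {φ ψ : FullProduct ι →⋆ₐ[ℂ] D}
    (h : ∀ k a, φ (inFull ι k a) = ψ (inFull ι k a)) : φ = ψ := by
  have h1 : Continuous φ := by fun_prop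
  have h2 : Continuous ψ := by fun_prop
  refine DFunLike.coe_injective
    ((fullSeminorm ι).denseRange_coeC.equalizer h1 h2 (funext fun x => ?_))
  change φ ((fullSeminorm ι).toCompletion x) = ψ ((fullSeminorm ι).toCompletion x)
  induction x using FreeStar.induction with
  | hc c => simp only [AlgHomClass.commutes]
  | hl k a => exact h k a
  | hm x y hx hy => rw [map_mul, map_mul, hx, hy, map_mul]
  | ha x y hx hy => rw [map_add, map_add, hx, hy, map_add]

variable {C : Type w} [CStarAlgebra C] [PartialOrder C] [StarOrderedRing C]

theorem StarSubalgebra.dense_of_topologicalClosure_eq_top {S : StarSubalgebra ℂ C}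
    (h : S.topologicalClosure = ⊤) : Dense (S : Set C) := by
  rw [dense_iff_closure_eq, ← StarSubalgebra.topologicalClosure_coe, h]
  rfl

/-- Generating `⋆`-homomorphisms with GNS-faithful vertex maps are unital: `q = 1 - ν 1` is a
projection with `q C = ℂ q`, which is killed by the vertex maps and hence by their GNS
representations. -/
theorem map_one_of_gnsFaithful {ν : ∀ k, A k →⋆ₙₐ[ℂ] C} {F : ∀ k, C →CP A k}
    (hB : ∀ b, ν 0 (ι 0 b) = ν 1 (ι 1 b))
    (hgen : (StarAlgebra.adjoin ℂ (⋃ k, Set.range (ν k))).topologicalClosure = ⊤)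
    (hF : ∀ k, IsVertexMap E (fun j => ν j) k (F k)) (hfaith : GNSFaithful F) (k : Fin 2) :
    ν k 1 = 1 := by
  have hp (j : Fin 2) : ν j 1 = ν 0 1 := by
    have h := hB 1
    rw [map_one (ι 0), map_one (ι 1)] at h
    fin_cases j
    · rfl
    · exact h.symm
  set q : C := 1 - ν 0 1 with hq
  have hqs : star q = q := by rw [hq, star_sub, star_one, ← map_star, star_one]
  have hqq : q * q = q := by
    rw [hq, mul_sub, sub_mul, sub_mul, ← map_mul]
    simp
  have hqF (j : Fin 2) : F j q = 0 := by
    rw [hq, ← hp j, map_sub, (hF j).map_one, (hF j).map_incl, sub_self]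
  have hadj (y : C) (hy : y ∈ StarAlgebra.adjoin ℂ (⋃ k, Set.range (ν k))) :
      ∃ c d : ℂ, q * y = c • q ∧ y * q = d • q := by
    induction hy using StarAlgebra.adjoin_induction with
    | mem y hy =>
      obtain ⟨j, a, rfl⟩ := Set.mem_iUnion.mp hy
      refine ⟨0, 0, ?_, ?_⟩
      · rw [hq, ← hp j, sub_mul, ← map_mul, one_mul, one_mul, sub_self, zero_smul]
      · rw [hq, ← hp j, mul_sub, ← map_mul, mul_one, mul_one, sub_self, zero_smul]
    | algebraMap c =>
      exact ⟨c, c, by rw [← Algebra.commutes, Algebra.smul_def], by rw [Algebra.smul_def]⟩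
    | add x y _ _ hx hy =>
      obtain ⟨c, d, h1, h2⟩ := hx
      obtain ⟨c', d', h3, h4⟩ := hy
      exact ⟨c + c', d + d', by rw [mul_add, h1, h3, add_smul], by rw [add_mul, h2, h4, add_smul]⟩
    | mul x y _ _ hx hy =>
      obtain ⟨c, d, h1, h2⟩ := hx
      obtain ⟨c', d', h3, h4⟩ := hy
      exact ⟨c * c', d' * d, by rw [← mul_assoc, h1, smul_mul_assoc, h3, smul_smul],
        by rw [mul_assoc, h4, mul_smul_comm, h2, smul_smul]⟩
    | star x _ hx =>
      obtain ⟨c, d, h1, h2⟩ := hx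
      refine ⟨star d, star c, ?_, ?_⟩
      · rw [← hqs, ← star_mul, hqs, h2, star_smul, hqs]
      · rw [← hqs, ← star_mul, hqs, h1, star_smul, hqs]
  have hdense := StarSubalgebra.dense_of_topologicalClosure_eq_top hgen
  have hzero : q = 0 := by
    refine hfaith q fun j => (gnsRep_eq_zero_iff _ _).mpr fun x y => ?_
    refine hdense.induction (P := fun x => F j (star x * q * y) = 0) (fun x hx => ?_)
      (isClosed_eq (by fun_prop) continuous_const) x
    refine hdense.induction (P := fun y => F j (star x * q * y) = 0) (fun y hy => ?_)
      (isClosed_eq (by fun_prop) continuous_const) y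
    obtain ⟨c, -, hc, -⟩ := hadj y hy
    obtain ⟨-, d, -, hd⟩ := hadj _ (star_mem hx)
    rw [mul_assoc, hc, mul_smul_comm, hd, map_smul, map_smul, hqF, smul_zero, smul_zero]
  rw [hp k]
  exact (sub_eq_zero.mp hzero).symm

variable {F : ∀ k, C →CP A k} {ν : ∀ k, A k → C} {φ : FullProduct ι →⋆ₐ[ℂ] C}

/-- The kernel of `A_f → C` does not depend on `C`, if there are GNS-faithful vertex maps on `C`. -/
theorem apply_eq_zero_iff_fullState (hF : ∀ k, IsVertexMap E ν k (F k)) (hfaith : GNSFaithful F)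
    (hφ : ∀ k a, φ (inFull ι k a) = ν k a) (hdense : DenseRange φ) (x : FullProduct ι) :
    φ x = 0 ↔ ∀ k y z, fullState E k (star y * x * z) = 0 := by
  constructor
  · intro h k y z
    rw [← (hF k).apply_eq_fullState φ hφ, map_mul φ, map_mul φ, h, mul_zero, zero_mul, map_zero]
  · intro h
    refine hfaith _ fun k => (gnsRep_eq_zero_iff _ _).mpr fun y z => ?_
    refine hdense.induction_on (p := fun y => F k (star y * φ x * z) = 0) y
      (isClosed_eq (by fun_prop) continuous_const) fun y => ?_
    refine hdense.induction_on (p := fun z => F k (star (φ y) * φ x * z) = 0) z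
      (isClosed_eq (by fun_prop) continuous_const) fun z => ?_
    rw [← map_star φ, ← map_mul φ, ← map_mul φ, (hF k).apply_eq_fullState φ hφ, h]

/-- `A_f → A_v` and `A_f → C` have the same kernel, hence give the same seminorm on `A_f`, and so
`A_v` and `C` are completions of `A_f` in the same seminorm. -/
theorem exists_starAlgEquiv_vertexProduct (hF : ∀ k, IsVertexMap E ν k (F k))
    (hfaith : GNSFaithful F) (hφ : ∀ k a, φ (inFull ι k a) = ν k a) (hdense : DenseRange φ) :
    ∃ Φ : VertexProduct E ≃⋆ₐ[ℂ] C, ∀ x, Φ (toVertex E x) = φ x := by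
  have hker (x : FullProduct ι) : toVertex E x = 0 ↔ φ x = 0 :=
    (apply_eq_zero_iff_fullState (isVertexMap_vertexState E) (gnsFaithful_vertexState E)
      (fun _ _ => rfl) (denseRange_toVertex E) x).trans
      (apply_eq_zero_iff_fullState hF hfaith hφ hdense x).symm
  have hnorm (x : FullProduct ι) : ‖φ x‖ = ‖toVertex E x‖ :=
    le_antisymm ((toVertex E).norm_apply_le_of_ker_le φ (fun x => (hker x).mp) x)
      (φ.norm_apply_le_of_ker_le (toVertex E) (fun x => (hker x).mpr) x)
  let Ψ : VertexProduct E →⋆ₐ[ℂ] C := CStarSeminorm.lift (q := vertexSeminorm E) φ fun x =>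
    (hnorm x).le.trans (norm_toVertex E x).le
  have hΨ (x : FullProduct ι) : Ψ (toVertex E x) = φ x := CStarSeminorm.lift_toCompletion _ _ x
  have hcont : Continuous Ψ := by fun_prop
  have hiso : Isometry Ψ := by
    refine AddMonoidHomClass.isometry_of_norm Ψ fun c => ?_
    refine congrFun ((denseRange_toVertex E).equalizer hcont.norm continuous_norm
      (funext fun x => ?_)) c
    simp only [Function.comp_apply, hΨ, hnorm]
  have hsurj : Function.Surjective Ψ := by
    have h1 : IsClosed (Set.range Ψ) := hiso.isClosedEmbedding.isClosed_range
    have h2 : DenseRange Ψ := hdense.mono (by rintro _ ⟨x, rfl⟩; exact ⟨_, hΨ x⟩)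
    exact Set.range_eq_univ.mp (h1.closure_eq ▸ h2.closure_range)
  exact ⟨StarAlgEquiv.ofBijective Ψ ⟨hiso.injective, hsurj⟩, hΨ⟩

end Characterization

/-- The fundamental properties of the vertex-reduced amalgamated free product. -/
theorem mainTheorem6 {A : Fin 2 → Type u} [∀ k, CStarAlgebra (A k)] [∀ k, PartialOrder (A k)]
    [∀ k, StarOrderedRing (A k)] {B : Type v} [CStarAlgebra B] [PartialOrder B] [StarOrderedRing B]
    (ι : ∀ k, B →⋆ₐ[ℂ] A k) (E : ∀ k, CondExp (ι k)) :
    (∀ k, Function.Injective fun a : A k => toVertex E (inFull ι k a)) ∧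
    (∀ k, ∃! 𝔼 : VertexProduct E →CP A k,
      IsVertexMap E (fun j a => toVertex E (inFull ι j a)) k 𝔼) ∧
    ∀ 𝔼 : ∀ k, VertexProduct E →CP A k,
      (∀ k, IsVertexMap E (fun j a => toVertex E (inFull ι j a)) k (𝔼 k)) →
      GNSFaithful 𝔼 ∧
      ∀ (C : Type w) [CStarAlgebra C] [PartialOrder C] [StarOrderedRing C]
        (ν : ∀ k, A k →⋆ₙₐ[ℂ] C) (F : ∀ k, C →CP A k),
        (∀ b, ν 0 (ι 0 b) = ν 1 (ι 1 b)) →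
        (StarAlgebra.adjoin ℂ (⋃ k, Set.range (ν k))).topologicalClosure = ⊤ →
        (∀ k, Function.Injective (ν k)) →
        (∀ k, IsVertexMap E (fun j => ν j) k (F k)) →
        GNSFaithful F →
        (∃! Φ : VertexProduct E ≃⋆ₐ[ℂ] C, ∀ k a, Φ (toVertex E (inFull ι k a)) = ν k a) ∧
        ∀ Φ : VertexProduct E ≃⋆ₐ[ℂ] C, (∀ k a, Φ (toVertex E (inFull ι k a)) = ν k a) →
          ∀ k x, F k (Φ x) = 𝔼 k x := by
  refine ⟨fun k => ?_, fun k => ⟨vertexState E k, isVertexMap_vertexState E k,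
    fun F hF => hF.eq_vertexState⟩, fun 𝔼 h𝔼 => ?_⟩
  · refine Function.LeftInverse.injective (g := vertexState E k) fun a => ?_
    rw [vertexState_toVertex, fullState_inFull]
  obtain rfl : 𝔼 = vertexState E := funext fun k => (h𝔼 k).eq_vertexState
  refine ⟨gnsFaithful_vertexState E, fun C _ _ _ ν F hB hgen _ hF hfaith => ?_⟩
  have hone := map_one_of_gnsFaithful hB hgen hF hfaith
  let ν' (k : Fin 2) : A k →⋆ₐ[ℂ] C :=
    { ν k with
      map_one' := hone k
      commutes' := fun c => by
        change ν k _ = _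
        rw [Algebra.algebraMap_eq_smul_one, map_smul, hone, Algebra.algebraMap_eq_smul_one] }
  let φ : FullProduct ι →⋆ₐ[ℂ] C := fullLift' ν' hB
  have hφ (k : Fin 2) (a : A k) : φ (inFull ι k a) = ν k a := fullLift'_inFull ν' hB k a
  have hdense : DenseRange φ := by
    have hle : StarAlgebra.adjoin ℂ (⋃ k, Set.range (ν k)) ≤ φ.range := by
      refine StarAlgebra.adjoin_le (Set.iUnion_subset fun k => ?_)
      rintro _ ⟨a, rfl⟩
      exact ⟨inFull ι k a, hφ k a⟩
    exact (StarSubalgebra.dense_of_topologicalClosure_eq_top hgen).mono hle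
  -- An isomorphism that is correct on the letters is correct on the image of `A_f`.
  have hext (Φ : VertexProduct E ≃⋆ₐ[ℂ] C) (hΦ : ∀ k a, Φ (toVertex E (inFull ι k a)) = ν k a)
      (x : FullProduct ι) : Φ (toVertex E x) = φ x := by
    have : (Φ : VertexProduct E →⋆ₐ[ℂ] C).comp (toVertex E) = φ :=
      FullProduct.hom_ext fun k a => (hΦ k a).trans (hφ k a).symm
    exact DFunLike.congr_fun this x
  obtain ⟨Φ, hΦ⟩ := exists_starAlgEquiv_vertexProduct hF hfaith hφ hdense
  refine ⟨⟨Φ, fun k a => (hΦ _).trans (hφ k a), fun Φ' hΦ' => ?_⟩, fun Φ' hΦ' k x => ?_⟩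
  · have h1 : Continuous Φ := by fun_prop
    have h2 : Continuous Φ' := by fun_prop
    refine DFunLike.coe_injective ((denseRange_toVertex E).equalizer h2 h1 (funext fun x => ?_))
    exact (hext Φ' hΦ' x).trans (hΦ x).symm
  · have h1 : Continuous Φ' := by fun_prop
    have h2 : Continuous fun x => F k (Φ' x) := by fun_prop
    have h3 : Continuous (vertexState E k) := by fun_prop
    refine congrFun ((denseRange_toVertex E).equalizer h2 h3 (funext fun x => ?_)) x
    simp only [Function.comp_apply, hext Φ' hΦ', vertexState_toVertex]
    exact (hF k).apply_eq_fullState φ hφ x
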